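/- Let $d\ge 1$ and let $G$ be $\mathbb R^d$ or $\mathbb Z^d$, acting on $\mathbb R^d$ by translations. A prototile is a labelled closed topological disk in $\mathbb R^d$; given a finite set of prototiles, a tile is a $G$-translate of a prototile, a patch is a finite set of tiles that overlap only on their boundaries and have connected union (its support), and a tiling is a set of tiles that cover $\mathbb R^d$ and overlap only on their boundaries. A fusion rule $\mathcal R$ consists of finite families $\mathcal P_n=\{P_n(1),\dots,P_n(j_n)\}$, $n\ge 0$, of patches ($n$-supertiles), where $\mathcal P_0$ is the set of prototiles and every $P_{n+1}(l)$ is a union of $G$-translates of $n$-supertiles whose supports overlap only on their boundaries (one such decomposition is fixed). Its transition matrices are $M_{n,n+1}(k,l)=$ the number of $n$-supertiles of type $k$ in $P_{n+1}(l)$. The space $X_{\mathcal R}$ consists of all tilings each of whose patches has a $G$-translate contained in some supertile. It carries the $\sigma$-algebra generated by the cylinder sets $X_{P,U}=\{\mathbf T: P-v\subseteq \mathbf T\text{ for some } v\in U\}$ ($P$ a patch, $U\subseteq G$ Borel), and $G$ acts on it by translation. $\mathcal R$ is strongly primitive if all entries of $M_{n,n+1}$ are positive for every $n\ge 1$, and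 van Hove if, for every sequence $(A_n)$ in which $A_n$ is the support of an $n$-supertile, and every $r\ge0$, $\mathrm{Vol}(\{x:\mathrm{dist}(x,\partial A_n)\le r\})/\mathrm{Vol}(A_n)\to 0$. A tiling has finite local complexity if it contains, up to translation by $G$, only finitely many patches consisting of two tiles. A $G$-invariant probability measure $\mu$ on $X_{\mathcal R}$ is strongly mixing if $\mu(A\cap(B-v_n))\to\mu(A)\mu(B)$ for all measurable $A,B$ and every sequence $v_n\in G$ with $|v_n|\to\infty$. **Theorem.** Let $\mathcal R$ be a strongly primitive van Hove fusion rule such that $j_n$ is the same for all $n\ge 1$ and the entries of all $M_{n,n+1}$, $n \ge 0$, are bounded by one constant. 1. If $G=\mathbb R^d$ and all tilings in $X_{\mathcal R}$ have finite local complexity, then no $\mathbb R^d$-invariant probability measure on $X_{\mathcal R}$ is strongly mixing. 2. If $G=\mathbb Z^d$ and $X_{\mathcal R}$ has more than one element, then no $\mathbb Z^d$-invariant probability measure on $X_{\mathcal R}$ is strongly mixing. -/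

import Mathlib

open Set Filter Topology MeasureTheory

namespace FusionTiling

/-- Euclidean `d`-space. -/
abbrev E (d : ℕ) : Type := EuclideanSpace ℝ (Fin d)

/-- The group `ℤ^d` of translations by vectors with integer coordinates. -/
def integerLattice (d : ℕ) : AddSubgroup (E d) where
  carrier := {x | ∀ i, ∃ m : ℤ, x i = m}
  zero_mem' := fun i => ⟨0, by simp⟩
  add_mem' := by
    intro x y hx hy i
    obtain ⟨m, hm⟩ := hx i
    obtain ⟨k, hk⟩ := hy i
    exact ⟨m + k, by simp [hm, hk]⟩
  neg_mem' := by
    intro x hx i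
    obtain ⟨m, hm⟩ := hx i
    exact ⟨-m, by simp [hm]⟩

/-- `S` is a closed topological disk in `ℝ^d`: a homeomorphic image of the closed unit ball, the
open ball going onto the interior of `S` and so the unit sphere onto the boundary. (By invariance
of domain this last clause holds for every homeomorphic image of the closed unit ball in `ℝ^d`.) -/
def IsClosedDisk {d : ℕ} (S : Set (E d)) : Prop :=
  ∃ f : E d → E d, ContinuousOn f (Metric.closedBall 0 1) ∧ InjOn f (Metric.closedBall 0 1) ∧
    f '' Metric.closedBall 0 1 = S ∧ f '' Metric.ball 0 1 = interior S

/-- `A` and `B` meet only on their boundaries. -/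
def OverlapOnlyOnBoundary {d : ℕ} (A B : Set (E d)) : Prop :=
  A ∩ B ⊆ frontier A ∩ frontier B

/-- A sequence of sets is van Hove: `Vol ((∂ A_n)^{+r}) / Vol (A_n) → 0` for every `r ≥ 0`, with
`B^{+r}` the set of points at distance at most `r` from `B`. -/
def IsVanHove {d : ℕ} (A : ℕ → Set (E d)) : Prop :=
  ∀ r : ℝ, 0 ≤ r →
    Tendsto (fun n => volume (Metric.cthickening r (frontier (A n))) / volume (A n)) atTop (𝓝 0)

section Tiles

variable {d : ℕ} {G : AddSubgroup (E d)} {ι : Type}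

/-- The set covered by a tile. Given prototiles with labels `i : ι` and supports `shape i`, the tile
`(i, g)` is the prototile `i` translated by `g ∈ G`. -/
def tileSupport (shape : ι → Set (E d)) (t : ι × G) : Set (E d) :=
  (fun x => x + (t.2 : E d)) '' shape t.1

/-- The set covered by a collection of tiles. -/
def support (shape : ι → Set (E d)) (Q : Set (ι × G)) : Set (E d) :=
  ⋃ t ∈ Q, tileSupport shape t

/-- The translated collection of tiles `Q + g`. -/
def shift (g : G) (Q : Set (ι × G)) : Set (ι × G) :=
  (fun t => (t.1, t.2 + g)) '' Q

/-- A patch: a finite collection of tiles overlapping only on their boundaries, whose union is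
connected (in particular non-empty). -/
structure IsPatch (shape : ι → Set (E d)) (Q : Set (ι × G)) : Prop where
  finite : Q.Finite
  overlap : Q.Pairwise fun s t => OverlapOnlyOnBoundary (tileSupport shape s) (tileSupport shape t)
  connected : IsConnected (support shape Q)

/-- A tiling of `ℝ^d`: a collection of tiles covering `ℝ^d` and overlapping only on their
boundaries. -/
structure IsTiling (shape : ι → Set (E d)) (T : Set (ι × G)) : Prop where
  overlap : T.Pairwise fun s t => OverlapOnlyOnBoundary (tileSupport shape s) (tileSupport shape t)
  covers : support shape T = univ

/-- Finite local complexity with respect to `G`: up to translations in `G`, the tiling contains only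
finitely many connected two-tile patches. -/
def HasFLC (shape : ι → Set (E d)) (T : Set (ι × G)) : Prop :=
  ∃ F : Set (Set (ι × G)), F.Finite ∧
    ∀ Q ⊆ T, IsPatch shape Q → Q.ncard = 2 → ∃ g : G, shift g Q ∈ F

theorem mem_shift (g : G) (Q : Set (ι × G)) (t : ι × G) :
    t ∈ shift g Q ↔ (t.1, t.2 - g) ∈ Q := by
  constructor
  · rintro ⟨s, hs, rfl⟩
    simpa using hs
  · intro h
    exact ⟨_, h, by simp⟩

theorem shift_shift (g h : G) (Q : Set (ι × G)) : shift g (shift h Q) = shift (h + g) Q := by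
  ext t
  simp only [mem_shift]
  rw [show t.2 - g - h = t.2 - (h + g) by abel]

theorem shift_zero (Q : Set (ι × G)) : shift (0 : G) Q = Q := by
  ext t
  simp [mem_shift]

theorem shift_mono {g : G} {Q Q' : Set (ι × G)} (h : Q ⊆ Q') : shift g Q ⊆ shift g Q' :=
  image_mono h

theorem tileSupport_add (shape : ι → Set (E d)) (t : ι × G) (g : G) :
    tileSupport shape (t.1, t.2 + g) = Homeomorph.addRight (g : E d) '' tileSupport shape t := by
  simp only [tileSupport, image_image]
  refine image_congr fun x _ => ?_
  simp [add_assoc]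

theorem support_shift (shape : ι → Set (E d)) (g : G) (Q : Set (ι × G)) :
    support shape (shift g Q) = Homeomorph.addRight (g : E d) '' support shape Q := by
  simp only [support, shift, biUnion_image, image_iUnion, tileSupport_add]

theorem OverlapOnlyOnBoundary.image {A B : Set (E d)} (h : OverlapOnlyOnBoundary A B)
    (e : E d ≃ₜ E d) : OverlapOnlyOnBoundary (e '' A) (e '' B) := by
  unfold OverlapOnlyOnBoundary at *
  rw [← e.image_frontier, ← e.image_frontier, ← image_inter e.injective,
    ← image_inter e.injective]
  exact image_mono h

theorem pairwise_shift {shape : ι → Set (E d)} {Q : Set (ι × G)} (g : G)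
    (h : Q.Pairwise fun s t =>
      OverlapOnlyOnBoundary (tileSupport shape s) (tileSupport shape t)) :
    (shift g Q).Pairwise fun s t =>
      OverlapOnlyOnBoundary (tileSupport shape s) (tileSupport shape t) := by
  rintro _ ⟨s, hs, rfl⟩ _ ⟨t, ht, rfl⟩ hst
  have hne : s ≠ t := by
    rintro rfl
    exact hst rfl
  simp only [tileSupport_add]
  exact (h hs ht hne).image _

theorem IsPatch.shift {shape : ι → Set (E d)} {Q : Set (ι × G)} (h : IsPatch shape Q) (g : G) :
    IsPatch shape (shift g Q) where
  finite := h.finite.image _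
  overlap := pairwise_shift g h.overlap
  connected := by
    rw [support_shift]
    exact h.connected.image _ (Homeomorph.continuous _).continuousOn

theorem IsTiling.shift {shape : ι → Set (E d)} {T : Set (ι × G)} (h : IsTiling shape T) (g : G) :
    IsTiling shape (shift g T) where
  overlap := pairwise_shift g h.overlap
  covers := by
    rw [support_shift, h.covers, image_univ, (Homeomorph.addRight (g : E d)).range_coe]

end Tiles

/-- A fusion rule in `ℝ^d` with group of translations `G`. There are `num n` types of
`n`-supertiles, the `0`-supertiles being the prototiles; every `(n+1)`-supertile is a fusion of
translated `n`-supertiles. -/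
structure FusionRule (d : ℕ) (G : AddSubgroup (E d)) where
  /-- the number `j_n` of types of `n`-supertiles -/
  num : ℕ → ℕ
  /-- the supports of the prototiles; the index of a prototile serves as its label -/
  shape : Fin (num 0) → Set (E d)
  isClosedDisk : ∀ i, IsClosedDisk (shape i)
  /-- the `n`-supertile `P_n(i)`, as a patch of tiles -/
  supertile : ∀ n, Fin (num n) → Set (Fin (num 0) × G)
  isPatch : ∀ n i, IsPatch shape (supertile n i)
  supertile_zero : ∀ i, supertile 0 i = {(i, 0)}
  /-- the (preferred) decomposition of `P_{n+1}(i)`: the set of all `(k, g)` such that `P_n(k) + g`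
  is one of the `n`-supertiles that are fused to make `P_{n+1}(i)` -/
  pieces : ∀ n, Fin (num (n + 1)) → Finset (Fin (num n) × G)
  pieces_overlap : ∀ n i, (pieces n i : Set (Fin (num n) × G)).Pairwise fun a b =>
    OverlapOnlyOnBoundary (support shape (shift a.2 (supertile n a.1)))
      (support shape (shift b.2 (supertile n b.1)))
  supertile_succ : ∀ n i, supertile (n + 1) i = ⋃ a ∈ pieces n i, shift a.2 (supertile n a.1)

namespace FusionRule

variable {d : ℕ} {G : AddSubgroup (E d)} (R : FusionRule d G)

/-- Tiles of the fusion rule: a prototile label and a translation. -/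
abbrev Tile : Type := Fin (R.num 0) × G

/-- The transition matrix `M_{n,n+1}`: its `(k, l)` entry is the number of `n`-supertiles of type `k`
in the `(n+1)`-supertile of type `l`. -/
noncomputable def transitionMatrix (n : ℕ) : Matrix (Fin (R.num n)) (Fin (R.num (n + 1))) ℕ :=
  Matrix.of fun k l => {g : G | (k, g) ∈ R.pieces n l}.ncard

/-- For every `n ≥ 1`, each `(n+1)`-supertile contains every type of `n`-supertile. -/
def StronglyPrimitive : Prop :=
  ∀ n, 1 ≤ n → ∀ k l, 0 < R.transitionMatrix n k l

/-- Every sequence of supports of one `n`-supertile for each `n` is a van Hove sequence. -/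
def VanHove : Prop :=
  ∀ k : ∀ n, Fin (R.num n), IsVanHove fun n => support R.shape (R.supertile n (k n))

/-- The number of supertiles is the same at all levels `n ≥ 1`. -/
def ConstantSupertileNumber : Prop :=
  ∃ J : ℕ, ∀ n, 1 ≤ n → R.num n = J

/-- The entries of the transition matrices are uniformly bounded. -/
def BoundedTransitionMatrices : Prop :=
  ∃ K : ℕ, ∀ n k l, R.transitionMatrix n k l ≤ K

/-- A patch is admitted if a copy of it is found inside some supertile. -/
def Admitted (Q : Set R.Tile) : Prop :=
  ∃ n i, ∃ g : G, shift g Q ⊆ R.supertile n i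

/-- A fusion tiling: a tiling all of whose patches are admitted by the fusion rule. -/
structure IsFusionTiling (T : Set R.Tile) : Prop where
  isTiling : IsTiling R.shape T
  admitted : ∀ Q ⊆ T, IsPatch R.shape Q → R.Admitted Q

/-- The space `X_R` of all fusion tilings of the fusion rule. -/
def TilingSpace : Type := {T : Set R.Tile // R.IsFusionTiling T}

/-- All fusion tilings of the rule have finite local complexity. -/
def FiniteLocalComplexity : Prop :=
  ∀ T : R.TilingSpace, HasFLC R.shape T.1

variable {R} in
theorem IsFusionTiling.shift {T : Set R.Tile} (h : R.IsFusionTiling T) (g : G) :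
    R.IsFusionTiling (shift g T) where
  isTiling := h.isTiling.shift g
  admitted := by
    intro Q hQ hp
    have hsub : FusionTiling.shift (-g) Q ⊆ T := by
      have := shift_mono (g := -g) hQ
      rwa [shift_shift, add_neg_cancel, shift_zero] at this
    obtain ⟨n, i, g', h'⟩ := h.admitted _ hsub (hp.shift _)
    rw [shift_shift] at h'
    exact ⟨n, i, _, h'⟩

/-- The action of the translation group on the tiling space, `T ↦ T + g`. -/
def translate (g : G) (T : R.TilingSpace) : R.TilingSpace :=
  ⟨shift g T.1, T.2.shift g⟩

/-- The cylinder set `X_{Q,U}` of all tilings that contain `Q - v` for some `v ∈ U`. -/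
def cylinder (Q : Set R.Tile) (U : Set G) : Set R.TilingSpace :=
  {T | ∃ v ∈ U, shift (-v) Q ⊆ T.1}

/-- The σ-algebra on the tiling space generated by the cylinder sets of patches. -/
instance : MeasurableSpace R.TilingSpace :=
  MeasurableSpace.generateFrom
    {A | ∃ Q U, IsPatch R.shape Q ∧ MeasurableSet U ∧ A = R.cylinder Q U}

/-- Invariance of a measure under the translations in `G`. -/
def IsInvariant (μ : Measure R.TilingSpace) : Prop :=
  ∀ g : G, MeasurePreserving (R.translate g) μ μ

/-- Strong mixing: `μ (A ∩ (B - v_n)) → μ (A) μ (B)` for all measurable `A`, `B` and all sequences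
`v_n` in `G` tending to infinity. Here `B - v = {T | T + v ∈ B}`. -/
def StronglyMixing (μ : Measure R.TilingSpace) : Prop :=
  ∀ A B : Set R.TilingSpace, MeasurableSet A → MeasurableSet B →
    ∀ v : ℕ → G, Tendsto (fun n => ‖(v n : E d)‖) atTop atTop →
      Tendsto (fun n => μ (A ∩ R.translate (v n) ⁻¹' B)) atTop (𝓝 (μ A * μ B))

end FusionRule

end FusionTiling

/-!
# Fusion rules of bounded type are not strongly mixing

For a finite collection `Q` of tiles and a mesh `ε`, let `A` be the set of fusion tilings that
contain a translate of `Q` by a vector of the half-open cell `[0, ε)^d` (`occursInCell`). The theorem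
rests on a dichotomy (`StronglyMixing.eq_zero_or_le`): under a strongly mixing invariant probability
measure `μ`, either `μ A = 0` or `μ A ≥ C⁻³`, where `C` bounds the number of `n`-supertiles in an
`(n+1)`-supertile, whatever `Q` and `ε` are.

The reason is recurrence along the hierarchy. Some `(n+2)`-supertile contains two copies of the
`n`-supertile in which `Q` occurs most often (`exists_two_copies`), and by strong primitivity every
`(n+3)`-supertile contains this `(n+2)`-supertile. Hence, if `w` is the displacement between the two
copies, every `(n+3)`-supertile contains at least `m` pairs of copies of `Q` displaced by `w`, where
`m` is the largest number of copies of `Q` inside an `n`-supertile. It contains at most `C³ m` copies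
of `Q` altogether, apart from those which cross the boundary of an `n`-supertile, and by the van Hove
property the latter are negligible for large `n` (`card_occurrences_copy_le`, `exists_pairs`).
Averaging over large cubes gives `μ A ≤ C³ μ (A ∩ (A - w)) + κ` with `κ` arbitrarily small and `w`
arbitrarily long (`exists_recurrence`), and strong mixing turns this into `μ A ≤ C³ (μ A)²`.

Supertiles need not be recognizable in a tiling. It is enough that, around any bounded set, a
fusion tiling admits some decomposition into `n`-supertiles
(`IsFusionTiling.exists_local_decomposition`). The averages are finite sums over a grid, chosen so
that each cell contains the base point of at most one copy of `Q`.

It remains to find a set `A` with `0 < μ A < C⁻³`. For `ℝ^d`, a single tile and a fine grid will do.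
For `ℤ^d`, a tile distinguishing two fusion tilings belongs to a random tiling with probability
strictly between `0` and `1` (`measure_mem_lt_one`), and by strong mixing finitely many far away
translates of this tile occur together with positive but arbitrarily small probability
(`StronglyMixing.exists_finite_small`).
-/

open scoped ENNReal

/-! ### Geometry of tiles and packings -/

namespace FusionTiling

variable {d : ℕ} {G : AddSubgroup (E d)}

theorem IsClosedDisk.isCompact {S : Set (E d)} (h : IsClosedDisk S) : IsCompact S := by
  obtain ⟨f, hf, -, rfl, -⟩ := h
  exact (isCompact_closedBall 0 1).image_of_continuousOn hf

theorem IsClosedDisk.isConnected {S : Set (E d)} (h : IsClosedDisk S) : IsConnected S := by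
  obtain ⟨f, hf, -, rfl, -⟩ := h
  exact ((convex_closedBall 0 1).isConnected ⟨0, by simp⟩).image f hf

theorem IsClosedDisk.nonempty_interior {S : Set (E d)} (h : IsClosedDisk S) :
    (interior S).Nonempty := by
  obtain ⟨f, -, -, -, hf⟩ := h
  rw [← hf]
  exact ⟨f 0, 0, by simp, rfl⟩

theorem OverlapOnlyOnBoundary.notMem_right {A B : Set (E d)} (h : OverlapOnlyOnBoundary A B)
    {x : E d} (hx : x ∈ interior A) : x ∉ B := fun hB =>
  (h ⟨interior_subset hx, hB⟩).1.2 hx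

theorem OverlapOnlyOnBoundary.mono {A B A' B' : Set (E d)} (h : OverlapOnlyOnBoundary A B)
    (hA : A' ⊆ A) (hB : B' ⊆ B) : OverlapOnlyOnBoundary A' B' := fun _ hx =>
  have hx' := h ⟨hA hx.1, hB hx.2⟩
  ⟨⟨subset_closure hx.1, fun hi => hx'.1.2 (interior_mono hA hi)⟩,
    ⟨subset_closure hx.2, fun hi => hx'.2.2 (interior_mono hB hi)⟩⟩

theorem OverlapOnlyOnBoundary.disjoint_interior {A B : Set (E d)}
    (h : OverlapOnlyOnBoundary A B) : Disjoint (interior A) (interior B) :=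
  Set.disjoint_left.2 fun _ hA hB => h.notMem_right hA (interior_subset hB)

theorem support_mono {ι : Type} {shape : ι → Set (E d)} {Q Q' : Set (ι × G)} (h : Q ⊆ Q') :
    support shape Q ⊆ support shape Q' := biUnion_subset_biUnion_left h

theorem tileSupport_subset_support {ι : Type} {shape : ι → Set (E d)} {Q : Set (ι × G)}
    {t : ι × G} (h : t ∈ Q) : tileSupport shape t ⊆ support shape Q :=
  subset_biUnion_of_mem (u := fun t => tileSupport shape t) h

theorem shift_subset_iff {ι : Type} {g : G} {Q Q' : Set (ι × G)} :
    shift g Q ⊆ Q' ↔ Q ⊆ shift (-g) Q' := by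
  constructor
  · intro h
    have := shift_mono (g := -g) h
    rwa [shift_shift, add_neg_cancel, shift_zero] at this
  · intro h
    have := shift_mono (g := g) h
    rwa [shift_shift, neg_add_cancel, shift_zero] at this

/-- A preconnected set which meets `A` and its complement meets the frontier of `A`. -/
theorem inter_frontier_nonempty {X : Type*} [TopologicalSpace X] {s A : Set X}
    (hs : IsPreconnected s) (h : (s ∩ A).Nonempty) (h' : (s ∩ Aᶜ).Nonempty) :
    (s ∩ frontier A).Nonempty := by
  by_contra hne
  have hd : ∀ x ∈ s, x ∉ frontier A := fun x hx hf => hne ⟨x, hx, hf⟩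
  obtain ⟨x, hx, hxA⟩ := h
  obtain ⟨y, hy, hyA⟩ := h'
  obtain ⟨z, -, hz, hz'⟩ := hs (interior A) (interior Aᶜ) isOpen_interior isOpen_interior
    (fun z hz => by
      by_cases hzA : z ∈ closure A
      · exact Or.inl (not_not.1 fun hi => hd z hz ⟨hzA, hi⟩)
      · exact Or.inr (by rwa [interior_compl]))
    ⟨x, hx, not_not.1 fun hi => hd x hx ⟨subset_closure hxA, hi⟩⟩
    ⟨y, hy, by
      rw [interior_compl]
      exact fun hc => hd y hy ⟨hc, fun hi => hyA (interior_subset hi)⟩⟩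
  exact interior_subset hz' (interior_subset hz)

theorem ball_subset_of_disjoint_frontier {A : Set (E d)} {x : E d} {r : ℝ} (hr : 0 < r)
    (hx : x ∈ A) (h : Disjoint (Metric.ball x r) (frontier A)) : Metric.ball x r ⊆ A := by
  intro y hy
  by_contra hyA
  obtain ⟨z, hz⟩ := inter_frontier_nonempty (convex_ball x r).isPreconnected
    ⟨x, Metric.mem_ball_self hr, hx⟩ ⟨y, hy, hyA⟩
  exact Set.disjoint_left.1 h hz.1 hz.2

theorem cthickening_image_addRight (g : E d) (r : ℝ) (S : Set (E d)) :
    Metric.cthickening r (Homeomorph.addRight g '' S)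
      = Homeomorph.addRight g '' Metric.cthickening r S := by
  ext x
  have h : Metric.infEDist x (Homeomorph.addRight g '' S) = Metric.infEDist (x - g) S := by
    have := Metric.infEDist_image (Φ := fun y : E d => y + g) (x := x - g) (t := S)
      (IsometryEquiv.addRight g).isometry
    simpa using this
  simp only [Metric.mem_cthickening_iff, h, mem_image]
  constructor
  · intro hx
    exact ⟨x - g, hx, by simp⟩
  · rintro ⟨y, hy, rfl⟩
    simpa using hy

theorem volume_image_addRight (g : E d) (S : Set (E d)) :
    volume (Homeomorph.addRight g '' S) = volume S := by
  simp [Set.image_add_right, measure_preimage_add_right]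

namespace FusionRule

variable (R : FusionRule d G)

theorem exists_centers : ∃ (c : Fin (R.num 0) → E d) (δ : ℝ), 0 < δ ∧
    ∀ i, Metric.ball (c i) δ ⊆ R.shape i := by
  have h : ∀ i, ∃ c : E d, ∃ δ > 0, Metric.ball c δ ⊆ R.shape i := by
    intro i
    obtain ⟨c, hc⟩ := (R.isClosedDisk i).nonempty_interior
    exact ⟨c, Metric.mem_nhds_iff.1 (mem_interior_iff_mem_nhds.1 hc)⟩
  choose c δ hδ hc using h
  obtain ⟨ε, hε, hεδ⟩ := Pi.exists_forall_pos_add_lt (x := fun _ => (0 : ℝ)) (y := δ) hδ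
  exact ⟨c, ε, hε, fun i => (Metric.ball_subset_ball (by simpa using (hεδ i).le)).trans (hc i)⟩

/-- A chosen interior point of each prototile. -/
noncomputable def center : Fin (R.num 0) → E d := R.exists_centers.choose

/-- A radius such that every prototile contains the ball of this radius around its centre. -/
noncomputable def inradius : ℝ := R.exists_centers.choose_spec.choose

theorem inradius_pos : 0 < R.inradius := R.exists_centers.choose_spec.choose_spec.1

/-- The chosen interior point of a tile. -/
noncomputable def tileCenter (t : R.Tile) : E d := R.center t.1 + t.2

theorem ball_subset_tileSupport (t : R.Tile) :
    Metric.ball (R.tileCenter t) R.inradius ⊆ tileSupport R.shape t := by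
  intro x hx
  refine ⟨x - t.2, R.exists_centers.choose_spec.choose_spec.2 t.1 ?_, by simp⟩
  change x - (t.2 : E d) ∈ Metric.ball (R.center t.1) R.inradius
  rw [Metric.mem_ball, dist_eq_norm] at hx ⊢
  convert hx using 2
  simp only [tileCenter]
  abel

theorem tileCenter_mem_interior (t : R.Tile) :
    R.tileCenter t ∈ interior (tileSupport R.shape t) :=
  interior_maximal (R.ball_subset_tileSupport t) Metric.isOpen_ball
    (Metric.mem_ball_self R.inradius_pos)

theorem tileCenter_mem (t : R.Tile) : R.tileCenter t ∈ tileSupport R.shape t :=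
  interior_subset (R.tileCenter_mem_interior t)

theorem tileCenter_add (t : R.Tile) (g : G) :
    R.tileCenter (t.1, t.2 + g) = R.tileCenter t + g := by
  simp [tileCenter, add_assoc]

/-- The tiles of the collection overlap only on their boundaries. -/
def IsPacking (T : Set R.Tile) : Prop :=
  T.Pairwise fun s t => OverlapOnlyOnBoundary (tileSupport R.shape s) (tileSupport R.shape t)

variable {R}

theorem IsPacking.eq_of_mem {T : Set R.Tile} (hT : R.IsPacking T) {s t : R.Tile} (hs : s ∈ T)
    (ht : t ∈ T) {x : E d} (hx : x ∈ Metric.ball (R.tileCenter s) R.inradius)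
    (hxt : x ∈ tileSupport R.shape t) : s = t := by
  by_contra hne
  exact (hT hs ht hne).notMem_right
    (interior_maximal (R.ball_subset_tileSupport s) Metric.isOpen_ball hx) hxt

theorem IsPacking.eq_of_tileCenter_mem {T : Set R.Tile} (hT : R.IsPacking T) {s t : R.Tile}
    (hs : s ∈ T) (ht : t ∈ T) (h : R.tileCenter s ∈ tileSupport R.shape t) : s = t :=
  hT.eq_of_mem hs ht (Metric.mem_ball_self R.inradius_pos) h

theorem IsPacking.pairwiseDisjoint_ball {T : Set R.Tile} (hT : R.IsPacking T) :
    T.PairwiseDisjoint fun t => Metric.ball (R.tileCenter t) R.inradius := by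
  intro s hs t ht hne
  exact Set.disjoint_left.2 fun x hx hx' =>
    hne (hT.eq_of_mem hs ht hx (R.ball_subset_tileSupport t hx'))

theorem isConnected_tileSupport (t : R.Tile) : IsConnected (tileSupport R.shape t) :=
  (R.isClosedDisk t.1).isConnected.image _ (by fun_prop)

theorem isCompact_tileSupport (t : R.Tile) : IsCompact (tileSupport R.shape t) :=
  (R.isClosedDisk t.1).isCompact.image (by fun_prop)

theorem isPatch_singleton (t : R.Tile) : IsPatch R.shape ({t} : Set R.Tile) where
  finite := finite_singleton t
  overlap := pairwise_singleton _ _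
  connected := by simpa [support] using isConnected_tileSupport t

theorem isCompact_support {Q : Set R.Tile} (hQ : Q.Finite) : IsCompact (support R.shape Q) :=
  hQ.isCompact_biUnion fun t _ => isCompact_tileSupport t

/-- Only finitely many tiles of a packing meet a given bounded set: around their centres they carry
disjoint balls of equal positive volume. -/
theorem IsPacking.finite_inter {T : Set R.Tile} (hT : R.IsPacking T) {B : Set (E d)}
    (hB : Bornology.IsBounded B) : {t ∈ T | (tileSupport R.shape t ∩ B).Nonempty}.Finite := by
  obtain ⟨ρ, hρ⟩ := hB.subset_closedBall 0
  have hΔ : ∃ Δ : ℝ, ∀ i, ∀ x ∈ R.shape i, dist x (R.center i) ≤ Δ := by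
    have h : ∀ i, ∃ Δ : ℝ, ∀ x ∈ R.shape i, dist x (R.center i) ≤ Δ := fun i => by
      obtain ⟨Δ, h⟩ := (R.isClosedDisk i).isCompact.isBounded.subset_closedBall (R.center i)
      exact ⟨Δ, fun x hx => h hx⟩
    choose Δ h using h
    obtain ⟨M, hM⟩ := (finite_range Δ).bddAbove
    exact ⟨M, fun i x hx => (h i x hx).trans (hM ⟨i, rfl⟩)⟩
  obtain ⟨Δ, hΔ⟩ := hΔ
  set F := {t ∈ T | (tileSupport R.shape t ∩ B).Nonempty}
  have hd : Pairwise (Function.onFun Disjoint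
      fun t : F => Metric.ball (R.tileCenter t.1) R.inradius) := by
    intro s t hst
    exact hT.pairwiseDisjoint_ball s.2.1 t.2.1 fun h => hst (Subtype.ext h)
  have hsub : (⋃ t : F, Metric.ball (R.tileCenter t.1) R.inradius) ⊆
      Metric.closedBall 0 (R.inradius + Δ + ρ) := by
    refine iUnion_subset fun ⟨t, ht, x, hx, hxB⟩ y hy => ?_
    obtain ⟨z, hz, rfl⟩ := hx
    have h1 := hΔ _ z hz
    have h2 : dist (z + (t.2 : E d)) 0 ≤ ρ := hρ hxB
    have h3 : dist y (R.tileCenter t) < R.inradius := hy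
    have h4 : dist (R.tileCenter t) (z + (t.2 : E d)) ≤ Δ := by
      simpa [tileCenter, dist_comm] using h1
    rw [Metric.mem_closedBall]
    linarith [dist_triangle4 y (R.tileCenter t) (z + (t.2 : E d)) 0]
  have hfin := Measure.finite_const_le_meas_of_disjoint_iUnion (volume : Measure (E d))
    (ε := volume (Metric.ball (0 : E d) R.inradius))
    (Metric.measure_ball_pos _ _ R.inradius_pos)
    (As := fun t : F => Metric.ball (R.tileCenter t.1) R.inradius)
    (fun _ => measurableSet_ball) hd
    ((measure_mono hsub).trans_lt measure_closedBall_lt_top).ne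
  have huniv : {t : F | volume (Metric.ball (0 : E d) R.inradius) ≤
      volume (Metric.ball (R.tileCenter t.1) R.inradius)} = univ := by
    ext t
    simp [Measure.addHaar_ball_center]
  rw [huniv] at hfin
  exact Set.finite_coe_iff.1 (Set.finite_univ_iff.1 hfin)

/-- The tiles of a tiling that meet a closed ball form a patch: they are finitely many, and the
ball together with each of them is connected. -/
theorem isPatch_inter_closedBall {T : Set R.Tile} (hT : IsTiling R.shape T) {ρ : ℝ} (hρ : 0 ≤ ρ) :
    IsPatch R.shape {t ∈ T | (tileSupport R.shape t ∩ Metric.closedBall 0 ρ).Nonempty} ∧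
    Metric.closedBall 0 ρ ⊆
      support R.shape {t ∈ T | (tileSupport R.shape t ∩ Metric.closedBall 0 ρ).Nonempty} := by
  set F := {t ∈ T | (tileSupport R.shape t ∩ Metric.closedBall 0 ρ).Nonempty}
  have hcov : Metric.closedBall 0 ρ ⊆ support R.shape F := by
    intro x hx
    have : x ∈ support R.shape T := by rw [hT.covers]; trivial
    obtain ⟨t, ht, hxt⟩ := mem_iUnion₂.1 this
    exact mem_iUnion₂.2 ⟨t, ⟨ht, x, hxt, hx⟩, hxt⟩
  have h0 : (0 : E d) ∈ Metric.closedBall 0 ρ := by simpa using hρ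
  refine ⟨⟨IsPacking.finite_inter hT.overlap Metric.isBounded_closedBall,
    hT.overlap.mono fun t ht => ht.1, ⟨0, hcov h0⟩, ?_⟩, hcov⟩
  have heq : support R.shape F =
      ⋃ t : F, (Metric.closedBall 0 ρ ∪ tileSupport R.shape t.1) := by
    apply Subset.antisymm
    · exact iUnion₂_subset fun t ht =>
        subset_iUnion_of_subset ⟨t, ht⟩ subset_union_right
    · exact iUnion_subset fun t => union_subset hcov (tileSupport_subset_support t.2)
  rw [heq]
  refine isPreconnected_iUnion ⟨0, mem_iInter.2 fun t => Or.inl h0⟩ fun t => ?_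
  obtain ⟨x, hx, hx'⟩ := t.2.2
  exact (convex_closedBall 0 ρ).isPreconnected.union x hx' hx
    (isConnected_tileSupport t.1).isPreconnected

end FusionRule
end FusionTiling

/-! ### Decomposition into supertiles -/

namespace FusionTiling
namespace FusionRule

variable {d : ℕ} {G : AddSubgroup (E d)} (R : FusionRule d G)

/-- The translate `P_n(k) + g` of an `n`-supertile, for `a = (k, g)`. -/
def copy (n : ℕ) (a : Fin (R.num n) × G) : Set R.Tile := shift a.2 (R.supertile n a.1)

/-- The support of the translated supertile `R.copy n a`. -/
def copySupport (n : ℕ) (a : Fin (R.num n) × G) : Set (E d) := support R.shape (R.copy n a)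

theorem copy_add (n : ℕ) (a : Fin (R.num n) × G) (g : G) :
    R.copy n (a.1, a.2 + g) = shift g (R.copy n a) := by
  simp [copy, shift_shift]

theorem copySupport_add (n : ℕ) (a : Fin (R.num n) × G) (g : G) :
    R.copySupport n (a.1, a.2 + g) = Homeomorph.addRight (g : E d) '' R.copySupport n a := by
  rw [copySupport, copy_add, support_shift, copySupport]

theorem copySupport_eq (n : ℕ) (a : Fin (R.num n) × G) :
    R.copySupport n a = Homeomorph.addRight (a.2 : E d) '' support R.shape (R.supertile n a.1) :=
  support_shift _ _ _

theorem copy_succ (n : ℕ) (a : Fin (R.num (n + 1)) × G) :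
    R.copy (n + 1) a = ⋃ b ∈ R.pieces n a.1, R.copy n (b.1, b.2 + a.2) := by
  simp only [copy_add]
  simp only [copy, R.supertile_succ]
  simp only [shift, image_iUnion]

theorem isPacking_copy (n : ℕ) (a : Fin (R.num n) × G) : R.IsPacking (R.copy n a) :=
  ((R.isPatch n a.1).shift a.2).overlap

theorem copy_finite (n : ℕ) (a : Fin (R.num n) × G) : (R.copy n a).Finite :=
  ((R.isPatch n a.1).shift a.2).finite

theorem copy_nonempty (n : ℕ) (a : Fin (R.num n) × G) : (R.copy n a).Nonempty := by
  obtain ⟨x, hx⟩ := ((R.isPatch n a.1).shift a.2).connected.nonempty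
  obtain ⟨t, ht, -⟩ := mem_iUnion₂.1 hx
  exact ⟨t, ht⟩

theorem tileCenter_mem_copySupport {n : ℕ} {a : Fin (R.num n) × G} {t : R.Tile}
    (ht : t ∈ R.copy n a) : R.tileCenter t ∈ interior (R.copySupport n a) :=
  interior_mono (tileSupport_subset_support ht) (R.tileCenter_mem_interior t)

theorem isCompact_copySupport (n : ℕ) (a : Fin (R.num n) × G) : IsCompact (R.copySupport n a) :=
  isCompact_support (R.copy_finite n a)

theorem disjoint_copy {n : ℕ} {a b : Fin (R.num n) × G}
    (h : OverlapOnlyOnBoundary (R.copySupport n a) (R.copySupport n b)) :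
    Disjoint (R.copy n a) (R.copy n b) :=
  Set.disjoint_left.2 fun _ ha hb => h.notMem_right (R.tileCenter_mem_copySupport ha)
    (interior_subset (R.tileCenter_mem_copySupport hb))

/-- A finite set of translated `n`-supertiles whose supports overlap only on their boundaries. -/
def IsPackingBy (n : ℕ) (F : Finset (Fin (R.num n) × G)) : Prop :=
  (F : Set (Fin (R.num n) × G)).Pairwise fun a b =>
    OverlapOnlyOnBoundary (R.copySupport n a) (R.copySupport n b)

variable {R}

theorem IsPackingBy.sum_volume_interior_le {n : ℕ} {F : Finset (Fin (R.num n) × G)}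
    (hF : R.IsPackingBy n F) {A : Set (E d)}
    (hA : ∀ a ∈ F, interior (R.copySupport n a) ⊆ A) :
    ∑ a ∈ F, volume (interior (R.copySupport n a)) ≤ volume A := by
  rw [← measure_biUnion_finset (fun a ha b hb hab => (hF ha hb hab).disjoint_interior)
    fun a _ => isOpen_interior.measurableSet]
  exact measure_mono (iUnion₂_subset hA)

variable (R)

theorem pieces_overlap_add (n : ℕ) (a : Fin (R.num (n + 1)) × G)
    {b c : Fin (R.num n) × G} (hb : b ∈ R.pieces n a.1) (hc : c ∈ R.pieces n a.1) (hbc : b ≠ c) :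
    OverlapOnlyOnBoundary (R.copySupport n (b.1, b.2 + a.2)) (R.copySupport n (c.1, c.2 + a.2)) := by
  rw [copySupport_add, copySupport_add]
  exact (R.pieces_overlap n a.1 hb hc hbc).image _

open Classical in
/-- Every supertile of level `n + j` is a union of `n`-supertiles overlapping only on their
boundaries; their number grows at most geometrically in `j`. -/
theorem exists_decomposition (n j : ℕ) :
    ∀ a : Fin (R.num (n + j)) × G, ∃ F : Finset (Fin (R.num n) × G),
      R.copy (n + j) a = ⋃ b ∈ F, R.copy n b ∧ R.IsPackingBy n F ∧
        ∀ C, (∀ m l, n ≤ m → (R.pieces m l).card ≤ C) → F.card ≤ C ^ j := by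
  induction j with
  | zero => exact fun a => ⟨{a}, by simp, by simp [IsPackingBy], by simp⟩
  | succ j ih =>
    intro a
    choose F hF hov hcard using ih
    refine ⟨(R.pieces (n + j) a.1).biUnion fun b => F (b.1, b.2 + a.2), ?_, ?_, ?_⟩
    · rw [show R.copy (n + (j + 1)) a = _ from R.copy_succ (n + j) a]
      simp only [Finset.set_biUnion_biUnion, hF]
    · intro x hx y hy hxy
      simp only [Finset.coe_biUnion, mem_iUnion, Finset.mem_coe] at hx hy
      obtain ⟨b, hb, hxb⟩ := hx
      obtain ⟨c, hc, hyc⟩ := hy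
      by_cases hbc : b = c
      · subst hbc
        exact hov _ hxb hyc hxy
      · refine (R.pieces_overlap_add (n + j) a hb hc hbc).mono (support_mono ?_) (support_mono ?_)
        · rw [hF]; exact subset_biUnion_of_mem (u := fun b => R.copy n b) hxb
        · rw [hF]; exact subset_biUnion_of_mem (u := fun b => R.copy n b) hyc
    · intro C hC
      refine (Finset.card_biUnion_le_card_mul _ _ _ fun b _ => hcard _ C hC).trans ?_
      rw [pow_succ, mul_comm]
      exact Nat.mul_le_mul_left _ (hC _ _ (by omega))

variable {R}

theorem exists_card_pieces_le (hJ : R.ConstantSupertileNumber)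
    (hK : R.BoundedTransitionMatrices) : ∃ C : ℕ, ∀ n l, 1 ≤ n → (R.pieces n l).card ≤ C := by
  classical
  obtain ⟨J, hJ⟩ := hJ
  obtain ⟨K, hK⟩ := hK
  refine ⟨K * J, fun n l hn => ?_⟩
  refine (Finset.card_le_mul_card_image (f := Prod.fst) _ K fun k _ => ?_).trans
    (Nat.mul_le_mul_left _ ?_)
  · refine le_trans ?_ (hK n k l)
    rw [transitionMatrix, Matrix.of_apply]
    have hinj : InjOn Prod.snd {x : Fin (R.num n) × G | x ∈ R.pieces n l ∧ x.1 = k} := by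
      rintro ⟨x, g⟩ ⟨-, hx⟩ ⟨y, h⟩ ⟨-, hy⟩ hgh
      exact Prod.ext (hx.trans hy.symm) hgh
    have himg : {g : G | (k, g) ∈ R.pieces n l} =
        Prod.snd '' {x : Fin (R.num n) × G | x ∈ R.pieces n l ∧ x.1 = k} := by
      ext g
      constructor
      · exact fun h => ⟨(k, g), ⟨h, rfl⟩, rfl⟩
      · rintro ⟨⟨x, h⟩, ⟨hx, rfl⟩, rfl⟩
        exact hx
    rw [himg, hinj.ncard_image, ← Set.ncard_coe_finset]
    simp
  · rw [← hJ n hn]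
    exact (Finset.card_le_univ _).trans (by simp)

theorem StronglyPrimitive.exists_mem_pieces (h : R.StronglyPrimitive) {n : ℕ} (hn : 1 ≤ n)
    (k : Fin (R.num n)) (l : Fin (R.num (n + 1))) : ∃ g, (k, g) ∈ R.pieces n l :=
  Set.nonempty_of_ncard_ne_zero (h n hn k l).ne'

theorem copy_subset_of_mem_pieces {n : ℕ} {a : Fin (R.num (n + 1)) × G} {b : Fin (R.num n) × G}
    (hb : b ∈ R.pieces n a.1) : R.copy n (b.1, b.2 + a.2) ⊆ R.copy (n + 1) a := by
  rw [copy_succ]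
  exact subset_biUnion_of_mem (u := fun b => R.copy n (b.1, b.2 + a.2)) hb

variable (R) in
/-- The supertiles of all levels up to `n` have bounded diameter. -/
theorem exists_diam_bound (n : ℕ) : ∃ Δ : ℝ, 0 ≤ Δ ∧ ∀ m ≤ n, ∀ a : Fin (R.num m) × G,
    ∀ x ∈ R.copySupport m a, ∀ y ∈ R.copySupport m a, dist x y ≤ Δ := by
  have hfin : (⋃ m ∈ Finset.range (n + 1), range fun k : Fin (R.num m) =>
      Metric.diam (support R.shape (R.supertile m k))).Finite :=
    (Finset.range (n + 1)).finite_toSet.biUnion fun m _ => finite_range _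
  obtain ⟨Δ, hΔ⟩ := hfin.bddAbove
  refine ⟨max Δ 0, le_max_right _ _, fun m hm a x hx y hy => ?_⟩
  rw [copySupport_eq] at hx hy
  obtain ⟨x, hx, rfl⟩ := hx
  obtain ⟨y, hy, rfl⟩ := hy
  have h1 : dist x y ≤ Δ :=
    (Metric.dist_le_diam_of_mem (isCompact_support (R.isPatch m a.1).finite).isBounded hx hy).trans
      (hΔ (mem_iUnion₂.2 ⟨m, Finset.mem_range.2 (by omega), a.1, rfl⟩))
  simpa using Or.inl h1

end FusionRule

theorem le_of_ball_subset (hd : 0 < d) {S : Set (E d)} {x : E d} {r Δ : ℝ} (hΔ : 0 ≤ Δ)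
    (hS : Metric.ball x r ⊆ S) (h : ∀ y ∈ S, ∀ z ∈ S, dist y z ≤ Δ) : r ≤ Δ := by
  by_contra! hlt
  set e : E d := EuclideanSpace.single ⟨0, hd⟩ ((Δ + r) / 2)
  have he : ‖e‖ = (Δ + r) / 2 := by
    rw [PiLp.norm_single, Real.norm_of_nonneg (by linarith)]
  have := h (x + e) (hS (by simp [he]; linarith)) x (hS (Metric.mem_ball_self (by linarith)))
  rw [dist_self_add_left, he] at this
  linarith

namespace FusionRule
variable {R : FusionRule d G}

open Classical in
/-- Near any bounded set, a fusion tiling is a union of `n`-supertiles overlapping only on their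
boundaries. A large patch of the tiling lies in some supertile; it is too large for this
supertile to be of level less than `n`, and so the supertile is a union of `n`-supertiles. -/
theorem IsFusionTiling.exists_local_decomposition (hd : 0 < d) {T : Set R.Tile}
    (hT : R.IsFusionTiling T) (n : ℕ) {B : Set (E d)} (hB : Bornology.IsBounded B) :
    ∃ D : Finset (Fin (R.num n) × G), R.IsPackingBy n D ∧ (∀ a ∈ D, R.copy n a ⊆ T) ∧
      (∀ a ∈ D, (R.copySupport n a ∩ B).Nonempty) ∧
      ∀ t ∈ T, (tileSupport R.shape t ∩ B).Nonempty → ∃ a ∈ D, t ∈ R.copy n a := by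
  obtain ⟨ρ₀, hρ₀⟩ := hB.subset_closedBall 0
  obtain ⟨Δ, hΔ0, hΔ⟩ := R.exists_diam_bound n
  set ρ := |ρ₀| + Δ + 1
  have hρpos : 0 < ρ := by positivity
  obtain ⟨hpatch, hcov⟩ := isPatch_inter_closedBall hT.isTiling hρpos.le
  set P := {t ∈ T | (tileSupport R.shape t ∩ Metric.closedBall 0 ρ).Nonempty}
  obtain ⟨m, i, g, hg⟩ := hT.admitted P (fun t ht => ht.1) hpatch
  have hPm : P ⊆ R.copy m (i, -g) := shift_subset_iff.1 hg
  have hnm : n ≤ m := by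
    by_contra! hlt
    have := le_of_ball_subset hd hΔ0
      (Metric.ball_subset_closedBall.trans (hcov.trans (support_mono hPm)))
      (hΔ m hlt.le (i, -g))
    linarith [abs_nonneg ρ₀]
  obtain ⟨j, rfl⟩ := Nat.exists_eq_add_of_le hnm
  -- tiles of the supertile around the ball belong to the tiling
  have hmem : ∀ s ∈ R.copy (n + j) (i, -g), R.tileCenter s ∈ Metric.closedBall 0 ρ → s ∈ T := by
    intro s hs hsρ
    obtain ⟨t, ht, hst⟩ := mem_iUnion₂.1 (hcov hsρ)
    rw [(R.isPacking_copy _ _).eq_of_tileCenter_mem hs (hPm ht) hst]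
    exact ht.1
  obtain ⟨F, hF, hov, -⟩ := R.exists_decomposition n j (i, -g)
  refine ⟨F.filter fun a => (R.copySupport n a ∩ B).Nonempty,
    hov.mono (Finset.filter_subset _ _), ?_, fun a ha => (Finset.mem_filter.1 ha).2, ?_⟩
  · intro a ha s hs
    obtain ⟨haF, x, hx, hxB⟩ := Finset.mem_filter.1 ha
    refine hmem s ?_ ?_
    · rw [hF]; exact mem_iUnion₂.2 ⟨a, haF, hs⟩
    · have h1 := hΔ n le_rfl a _ (interior_subset (R.tileCenter_mem_copySupport hs)) x hx
      have h2 : dist x 0 ≤ ρ₀ := hρ₀ hxB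
      rw [Metric.mem_closedBall]
      linarith [dist_triangle (R.tileCenter s) x 0, le_abs_self ρ₀]
  · rintro t ht ⟨x, hx, hxB⟩
    have h2 : dist x 0 ≤ ρ₀ := hρ₀ hxB
    have htP : t ∈ P := ⟨ht, x, hx, by
      rw [Metric.mem_closedBall]; linarith [le_abs_self ρ₀]⟩
    have := hPm htP
    rw [hF] at this
    obtain ⟨a, ha, hta⟩ := mem_iUnion₂.1 this
    exact ⟨a, Finset.mem_filter.2 ⟨ha, x, tileSupport_subset_support hta hx, hxB⟩, hta⟩

end FusionRule
end FusionTiling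

/-! ### Consequences of the van Hove property and of strong primitivity -/

namespace FusionTiling
namespace FusionRule

variable {d : ℕ} {G : AddSubgroup (E d)} {R : FusionRule d G}

theorem VanHove.eventually_le (h : R.VanHove) (hne : ∀ n, Nonempty (Fin (R.num n))) {η : ℝ≥0∞}
    (hη : 0 < η) {r : ℝ} (hr : 0 ≤ r) : ∀ᶠ n in atTop, ∀ k : Fin (R.num n),
      volume (Metric.cthickening r (frontier (support R.shape (R.supertile n k)))) /
        volume (support R.shape (R.supertile n k)) < η := by
  classical
  -- apply the hypothesis to a sequence that picks a bad supertile at each level having one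
  let k : ∀ n, Fin (R.num n) := fun n =>
    if hk : ∃ k : Fin (R.num n), ¬ volume (Metric.cthickening r
        (frontier (support R.shape (R.supertile n k)))) /
        volume (support R.shape (R.supertile n k)) < η then hk.choose
    else (hne n).some
  filter_upwards [(h k r hr).eventually (gt_mem_nhds hη)] with n hn
  by_contra! hk
  have hk' : ∃ k : Fin (R.num n), ¬ volume (Metric.cthickening r
        (frontier (support R.shape (R.supertile n k)))) /
        volume (support R.shape (R.supertile n k)) < η := by simpa using hk
  have hkn : k n = hk'.choose := dif_pos hk'
  rw [hkn] at hn
  exact hk'.choose_spec hn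

theorem volume_copySupport_pos (n : ℕ) (a : Fin (R.num n) × G) :
    0 < volume (R.copySupport n a) := by
  obtain ⟨t, ht⟩ := R.copy_nonempty n a
  exact (isOpen_interior.measure_pos _ ⟨_, R.tileCenter_mem_copySupport ht⟩).trans_le
    (measure_mono interior_subset)

theorem VanHove.eventually_le_volume (h : R.VanHove) (hne : ∀ n, Nonempty (Fin (R.num n)))
    {η : ℝ≥0∞} (hη : 0 < η) {r : ℝ} (hr : 0 ≤ r) :
    ∀ᶠ n in atTop, ∀ a : Fin (R.num n) × G,
      volume (Metric.cthickening r (frontier (R.copySupport n a))) <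
        η * volume (R.copySupport n a) := by
  filter_upwards [h.eventually_le hne hη hr] with n hn a
  have h1 := hn a.1
  have hpos := volume_copySupport_pos n a
  have hfin := (R.isCompact_copySupport n a).measure_lt_top (μ := volume)
  rw [copySupport_eq] at hpos hfin ⊢
  rw [← Homeomorph.image_frontier, cthickening_image_addRight, volume_image_addRight] at *
  rw [volume_image_addRight] at *
  rwa [ENNReal.div_lt_iff (Or.inl hpos.ne') (Or.inl hfin.ne)] at h1

/-- Since boundaries may have positive volume, the van Hove property has to be turned into a
comparison with the volume of the interior before it is summed over disjoint interiors. -/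
theorem VanHove.eventually_le_volume_interior (h : R.VanHove)
    (hne : ∀ n, Nonempty (Fin (R.num n))) {η : ℝ≥0∞} (hη : 0 < η) {r : ℝ}
    (hr : 0 ≤ r) : ∀ᶠ n in atTop, ∀ a : Fin (R.num n) × G,
      volume (Metric.cthickening r (frontier (R.copySupport n a))) ≤
        η * volume (interior (R.copySupport n a)) := by
  set θ : ℝ≥0∞ := min (η / 2) 2⁻¹ with hθ
  have hθ0 : 0 < θ := lt_min (ENNReal.half_pos hη.ne') (by simp)
  have hθ2 : θ ≤ 2⁻¹ := min_le_right _ _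
  filter_upwards [h.eventually_le_volume hne hθ0 hr] with n hn a
  set V := volume (R.copySupport n a)
  set I := volume (interior (R.copySupport n a))
  have hVfin : V ≠ ∞ := (R.isCompact_copySupport n a).measure_lt_top.ne
  have h1 : volume (frontier (R.copySupport n a)) ≤ 2⁻¹ * V :=
    (measure_mono (Metric.self_subset_cthickening _)).trans
      ((hn a).le.trans (mul_le_mul_left hθ2 _))
  have h2 : V ≤ I + 2⁻¹ * V := by
    refine (measure_mono ?_).trans ((measure_union_le _ _).trans (add_le_add le_rfl h1))
    rw [← closure_eq_interior_union_frontier]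
    exact subset_closure
  have h3 : V ≤ 2 * I := by
    have h4 : 2⁻¹ * V + 2⁻¹ * V ≤ I + 2⁻¹ * V := by
      rwa [← add_mul, ENNReal.inv_two_add_inv_two, one_mul]
    have h5 := (ENNReal.add_le_add_iff_right (ENNReal.mul_ne_top (by simp) hVfin)).1 h4
    calc V = 2 * (2⁻¹ * V) := by
          rw [← mul_assoc, ENNReal.mul_inv_cancel (by simp) (by simp), one_mul]
      _ ≤ 2 * I := by gcongr
  calc _ ≤ θ * V := (hn a).le
    _ ≤ (η / 2) * (2 * I) := by gcongr; exact min_le_left _ _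
    _ = η * I := by
      rw [← mul_assoc, ENNReal.div_mul_cancel (by simp) (by simp)]

/-- Van Hove supertiles contain arbitrarily large balls. -/
theorem VanHove.eventually_ball_subset (h : R.VanHove) (hne : ∀ n, Nonempty (Fin (R.num n)))
    {r : ℝ} (hr : 0 < r) : ∀ᶠ n in atTop, ∀ a : Fin (R.num n) × G,
      ∃ x, Metric.ball x r ⊆ R.copySupport n a := by
  filter_upwards [h.eventually_le_volume hne one_pos hr.le] with n hn a
  have h1 := hn a
  rw [one_mul] at h1
  obtain ⟨x, hx, hx'⟩ : ∃ x ∈ R.copySupport n a,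
      x ∉ Metric.cthickening r (frontier (R.copySupport n a)) := by
    by_contra! hcon
    exact absurd (measure_mono hcon) (not_le.2 h1)
  refine ⟨x, ball_subset_of_disjoint_frontier hr hx (Set.disjoint_left.2 fun y hy hyf => hx' ?_)⟩
  exact Metric.mem_cthickening_of_dist_le x y r _ hyf (by rw [dist_comm]; exact (Metric.mem_ball.1 hy).le)

/-- Two copies of a set containing a ball of radius `r` that overlap only on their boundaries are
displaced by at least `r`. -/
theorem le_norm_of_ball_subset {n : ℕ} {k : Fin (R.num n)} {g g' : G} {x : E d} {r : ℝ}
    (hx : Metric.ball x r ⊆ R.copySupport n (k, g))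
    (h : OverlapOnlyOnBoundary (R.copySupport n (k, g)) (R.copySupport n (k, g'))) :
    r ≤ ‖((g - g' : G) : E d)‖ := by
  by_contra! hlt
  have hr : 0 < r := (norm_nonneg _).trans_lt hlt
  refine h.notMem_right (interior_maximal hx Metric.isOpen_ball (Metric.mem_ball_self hr)) ?_
  have : ((k, g') : Fin (R.num n) × G) = (k, g + (g' - g)) := by simp
  rw [this, show ((k, g + (g' - g)) : Fin (R.num n) × G) = ((k, g).1, (k, g).2 + (g' - g)) from rfl,
    copySupport_add]
  refine ⟨x + ((g - g' : G) : E d), hx ?_, ?_⟩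
  · simpa using hlt
  · simp only [Homeomorph.coe_addRight, AddSubgroup.coe_sub]
    abel

/-- At arbitrarily high levels `n`, every type of `n`-supertile occurs twice in some
`(n+2)`-supertile. If there are two types of supertiles this is strong primitivity; if there is only
one, an `(n+1)`-supertile which is not a mere translate of an `n`-supertile will do. -/
theorem exists_two_copies (hd : 0 < d) (hP : R.StronglyPrimitive) (hV : R.VanHove)
    (hJ : R.ConstantSupertileNumber) (hne : ∀ n, Nonempty (Fin (R.num n))) (N : ℕ) :
    ∃ n, N ≤ n ∧ 1 ≤ n ∧ ∀ k : Fin (R.num n), ∃ l : Fin (R.num (n + 2)), ∃ g g' : G,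
      R.copy n (k, g) ⊆ R.copy (n + 2) (l, 0) ∧ R.copy n (k, g') ⊆ R.copy (n + 2) (l, 0) ∧
      OverlapOnlyOnBoundary (R.copySupport n (k, g)) (R.copySupport n (k, g')) := by
  obtain ⟨J, hJ⟩ := hJ
  have hJ1 : 1 ≤ J := by
    obtain ⟨k⟩ := hne 1
    rw [← hJ 1 le_rfl]
    exact k.pos
  rcases hJ1.eq_or_lt with rfl | hJ2
  · have hss : ∀ n, 1 ≤ n → Subsingleton (Fin (R.num n)) := fun n hn => by
      rw [hJ n hn]; infer_instance
    by_contra! hcon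
    have hcard : ∀ n, N + 1 ≤ n → ∀ l, (R.pieces n l).card ≤ 1 := by
      intro n hn l
      by_contra! hlt
      obtain ⟨k, hk⟩ := hcon n (by omega) (by omega)
      obtain ⟨⟨i, g⟩, ha, ⟨i', g'⟩, hb, hab⟩ := Finset.one_lt_card.1 hlt
      have := hss n (by omega)
      have hi : i = k := Subsingleton.elim i k
      have hi' : i' = k := Subsingleton.elim i' k
      rw [hi] at ha hab
      rw [hi'] at hb hab
      obtain ⟨l'⟩ := hne (n + 2)
      obtain ⟨h, hh⟩ := hP.exists_mem_pieces (n := n + 1) (by omega) l l'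
      have hsub : R.copy (n + 1) (l, h) ⊆ R.copy (n + 2) (l', 0) := by
        simpa using copy_subset_of_mem_pieces (a := (l', 0)) hh
      have h₁ : R.copy n (k, g + h) ⊆ R.copy (n + 1) (l, h) :=
        copy_subset_of_mem_pieces (n := n) (a := (l, h)) (b := (k, g)) ha
      have h₂ : R.copy n (k, g' + h) ⊆ R.copy (n + 1) (l, h) :=
        copy_subset_of_mem_pieces (n := n) (a := (l, h)) (b := (k, g')) hb
      have h₃ := R.pieces_overlap_add n (l, h) ha hb hab
      exact hk l' (g + h) (g' + h) (h₁.trans hsub) (h₂.trans hsub) h₃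
    have hconst : ∀ j, ∀ a : Fin (R.num (N + 1 + j)) × G, ∃ b : Fin (R.num (N + 1)) × G,
        R.copy (N + 1 + j) a = R.copy (N + 1) b := by
      intro j
      induction j with
      | zero => exact fun a => ⟨a, rfl⟩
      | succ j ih =>
        intro a
        obtain ⟨k⟩ := hne (N + 1 + j)
        obtain ⟨g, hg⟩ := hP.exists_mem_pieces (n := N + 1 + j) (by omega) k a.1
        obtain ⟨b, hb⟩ := ih (k, g + a.2)
        refine ⟨b, ?_⟩
        rw [← hb, show R.copy (N + 1 + (j + 1)) a = _ from R.copy_succ (N + 1 + j) a]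
        have : R.pieces (N + 1 + j) a.1 = {(k, g)} := by
          refine Finset.eq_singleton_iff_unique_mem.2 ⟨hg, fun x hx => ?_⟩
          exact Finset.card_le_one.1 (hcard (N + 1 + j) (by omega) a.1) _ hx _ hg
        simp [this]
    obtain ⟨Δ, hΔ0, hΔ⟩ := R.exists_diam_bound (N + 1)
    obtain ⟨m, hm⟩ := eventually_atTop.1
      (hV.eventually_ball_subset hne (r := Δ + 1) (by linarith))
    obtain ⟨k⟩ := hne (N + 1 + m)
    obtain ⟨x, hx⟩ := hm (N + 1 + m) (by omega) (k, 0)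
    obtain ⟨b, hb⟩ := hconst m (k, 0)
    rw [copySupport, hb] at hx
    have := le_of_ball_subset hd hΔ0 hx (hΔ _ le_rfl b)
    linarith
  · refine ⟨N + 1, by omega, by omega, fun k => ?_⟩
    obtain ⟨l⟩ := hne (N + 1 + 2)
    have hn : R.num (N + 1 + 1) = J := hJ _ (by omega)
    obtain ⟨k₁, k₂, hk⟩ : ∃ k₁ k₂ : Fin (R.num (N + 1 + 1)), k₁ ≠ k₂ :=
      ⟨⟨0, by omega⟩, ⟨1, by omega⟩, by simp⟩
    obtain ⟨h₁, hh₁⟩ := hP.exists_mem_pieces (n := N + 1 + 1) (by omega) k₁ l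
    obtain ⟨h₂, hh₂⟩ := hP.exists_mem_pieces (n := N + 1 + 1) (by omega) k₂ l
    obtain ⟨g₁, hg₁⟩ := hP.exists_mem_pieces (n := N + 1) (by omega) k k₁
    obtain ⟨g₂, hg₂⟩ := hP.exists_mem_pieces (n := N + 1) (by omega) k k₂
    have s₁ := copy_subset_of_mem_pieces (a := (k₁, h₁)) hg₁
    have s₂ := copy_subset_of_mem_pieces (a := (k₂, h₂)) hg₂
    have t₁ : R.copy (N + 1 + 1) (k₁, h₁) ⊆ R.copy (N + 1 + 2) (l, 0) := by
      simpa using copy_subset_of_mem_pieces (a := (l, 0)) hh₁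
    have t₂ : R.copy (N + 1 + 1) (k₂, h₂) ⊆ R.copy (N + 1 + 2) (l, 0) := by
      simpa using copy_subset_of_mem_pieces (a := (l, 0)) hh₂
    refine ⟨l, g₁ + h₁, g₂ + h₂, s₁.trans t₁, s₂.trans t₂, ?_⟩
    have := R.pieces_overlap_add (N + 1 + 1) (l, 0) hh₁ hh₂ fun h => hk (congrArg Prod.fst h)
    simp only [add_zero] at this
    exact this.mono (support_mono s₁) (support_mono s₂)

theorem nonempty_of_isFusionTiling (hd : 0 < d) {T : Set R.Tile} (hT : R.IsFusionTiling T)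
    (n : ℕ) : Nonempty (Fin (R.num n)) := by
  obtain ⟨D, -, -, -, hD⟩ := hT.exists_local_decomposition hd n
    (Bornology.isBounded_singleton (x := (0 : E d)))
  have h0 : (0 : E d) ∈ support R.shape T := by rw [hT.isTiling.covers]; trivial
  obtain ⟨t, ht, h0t⟩ := mem_iUnion₂.1 h0
  obtain ⟨a, -, -⟩ := hD t ht ⟨0, h0t, rfl⟩
  exact ⟨a.1⟩

/-- All fusion tilings contain the same types of tiles. -/
theorem IsFusionTiling.exists_tile (hd : 0 < d) (hP : R.StronglyPrimitive) {T T' : Set R.Tile}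
    (hT : R.IsFusionTiling T) (hT' : R.IsFusionTiling T') {t : R.Tile} (ht : t ∈ T) :
    ∃ g : G, (t.1, g) ∈ T' := by
  obtain ⟨D, -, -, -, hD⟩ := hT.exists_local_decomposition hd 1
    (Bornology.isBounded_singleton (x := R.tileCenter t))
  obtain ⟨a, -, hta⟩ := hD t ht ⟨_, R.tileCenter_mem t, rfl⟩
  obtain ⟨D', -, hD'T, -, hD'⟩ := hT'.exists_local_decomposition hd 2
    (Bornology.isBounded_singleton (x := (0 : E d)))
  have h0 : (0 : E d) ∈ support R.shape T' := by rw [hT'.isTiling.covers]; trivial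
  obtain ⟨s, hs, h0s⟩ := mem_iUnion₂.1 h0
  obtain ⟨b, hb, -⟩ := hD' s hs ⟨0, h0s, rfl⟩
  obtain ⟨g, hg⟩ := hP.exists_mem_pieces le_rfl a.1 b.1
  have h1 : R.copy 1 (a.1, g + b.2) ⊆ T' := (copy_subset_of_mem_pieces hg).trans (hD'T b hb)
  have h2 : (t.1, t.2 - a.2) ∈ R.supertile 1 a.1 := (mem_shift _ _ _).1 hta
  exact ⟨t.2 - a.2 + (g + b.2), h1 ⟨_, h2, rfl⟩⟩

end FusionRule
end FusionTiling

/-! ### Counting occurrences -/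

namespace FusionTiling
namespace FusionRule

variable {d : ℕ} {G : AddSubgroup (E d)} {R : FusionRule d G}

variable (R) in
/-- The number of translates of `Q` contained in the `n`-supertile `P_n(k)`. -/
noncomputable def occurrenceCount (Q : Set R.Tile) (n : ℕ) (k : Fin (R.num n)) : ℕ :=
  {y : G | shift y Q ⊆ R.supertile n k}.ncard

theorem mem_of_shift_subset {Q T : Set R.Tile} {q : R.Tile} (hq : q ∈ Q) {x : G}
    (h : shift x Q ⊆ T) : (q.1, q.2 + x) ∈ T := h ⟨q, hq, rfl⟩

theorem finite_occurrences {Q : Set R.Tile} {q : R.Tile} (hq : q ∈ Q) {T : Set R.Tile}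
    (hT : T.Finite) : {y : G | shift y Q ⊆ T}.Finite := by
  refine Set.Finite.of_finite_image (f := fun y => (q.1, q.2 + y)) (hT.subset ?_) ?_
  · rintro _ ⟨y, hy, rfl⟩
    exact mem_of_shift_subset hq hy
  · intro x _ y _ h
    exact add_left_cancel (congrArg Prod.snd h)

theorem shift_subset_copy_iff {Q : Set R.Tile} {n : ℕ} {a : Fin (R.num n) × G} {x : G} :
    shift x Q ⊆ R.copy n a ↔ shift (x - a.2) Q ⊆ R.supertile n a.1 := by
  rw [copy, shift_subset_iff, shift_shift, shift_subset_iff (g := x - a.2)]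
  simp [sub_eq_add_neg]

theorem card_le_occurrenceCount {Q : Set R.Tile} {q : R.Tile} (hq : q ∈ Q) {n : ℕ}
    {a : Fin (R.num n) × G} {O : Finset G} (hO : ∀ x ∈ O, shift x Q ⊆ R.copy n a) :
    O.card ≤ R.occurrenceCount Q n a.1 := by
  rw [← Set.ncard_coe_finset, occurrenceCount,
    ← Set.ncard_image_of_injective (O : Set G) (sub_left_injective (b := a.2))]
  refine Set.ncard_le_ncard ?_ (finite_occurrences hq (R.isPatch n a.1).finite)
  rintro _ ⟨x, hx, rfl⟩
  exact shift_subset_copy_iff.1 (hO x hx)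

/-- A translated `n`-supertile contained in a packing is crossed by few translates of `Q` from this
packing: those carry disjoint balls of fixed size near its boundary. -/
theorem card_crossing_le {T : Set R.Tile} (hT : R.IsPacking T) {n : ℕ} {a : Fin (R.num n) × G}
    (ha : R.copy n a ⊆ T) {Q : Set R.Tile} {q : R.Tile} (hq : q ∈ Q) {r : ℝ}
    (hr : ∀ s ∈ Q, dist (R.tileCenter s) (R.tileCenter q) ≤ r) {O : Finset G}
    (hO : ∀ x ∈ O, shift x Q ⊆ T ∧ (q.1, q.2 + x) ∈ R.copy n a ∧ ¬ shift x Q ⊆ R.copy n a) :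
    O.card * volume (Metric.ball (0 : E d) R.inradius) ≤
      volume (Metric.cthickening (R.inradius + r) (frontier (R.copySupport n a))) := by
  set f : G → R.Tile := fun x => (q.1, q.2 + x)
  have hf : Function.Injective f := fun x y h => add_left_cancel (congrArg Prod.snd h)
  have hdis : (O : Set G).PairwiseDisjoint
      fun x => Metric.ball (R.tileCenter (f x)) R.inradius := by
    intro x hx y hy hxy
    exact hT.pairwiseDisjoint_ball (mem_of_shift_subset hq (hO x hx).1)
      (mem_of_shift_subset hq (hO y hy).1) (hf.ne hxy)
  have hsum : ∑ x ∈ O, volume (Metric.ball (R.tileCenter (f x)) R.inradius) =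
      O.card * volume (Metric.ball (0 : E d) R.inradius) := by
    simp [Measure.addHaar_ball_center]
  rw [← hsum, ← measure_biUnion_finset hdis fun x _ => measurableSet_ball]
  refine measure_mono (iUnion₂_subset fun x hx y hy => ?_)
  obtain ⟨hxT, hxa, hxn⟩ := hO x hx
  obtain ⟨t, ht, hta⟩ := not_subset.1 hxn
  have htc : R.tileCenter t ∉ R.copySupport n a := by
    intro hmem
    obtain ⟨s, hs, hts⟩ := mem_iUnion₂.1 hmem
    exact hta (hT.eq_of_tileCenter_mem (hxT ht) (ha hs) hts ▸ hs)
  have hdist : dist (R.tileCenter t) (R.tileCenter (f x)) ≤ r := by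
    obtain ⟨s, hs, rfl⟩ := ht
    rw [R.tileCenter_add, show f x = (q.1, q.2 + x) from rfl, R.tileCenter_add, dist_add_right]
    exact hr s hs
  have hr0 : 0 ≤ r := dist_nonneg.trans hdist
  obtain ⟨z, hz, hzf⟩ := inter_frontier_nonempty
    (convex_closedBall (R.tileCenter (f x)) r).isPreconnected
    ⟨_, Metric.mem_closedBall_self hr0, interior_subset (R.tileCenter_mem_copySupport hxa)⟩
    ⟨_, hdist, htc⟩
  refine Metric.mem_cthickening_of_dist_le y z _ _ hzf ?_
  rw [Metric.mem_ball] at hy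
  rw [Metric.mem_closedBall, dist_comm] at hz
  linarith [dist_triangle y (R.tileCenter (f x)) z]

open Classical in
/-- The translates of `Q` based in a supertile of level `n + 3` lie inside one of boundedly many
`n`-supertiles, up to a number that is small compared with the volume. -/
theorem card_occurrences_copy_le {T : Set R.Tile} (hT : R.IsPacking T) {n : ℕ}
    {b : Fin (R.num (n + 3)) × G} (hb : R.copy (n + 3) b ⊆ T) {Q : Set R.Tile} {q : R.Tile}
    (hq : q ∈ Q) {r : ℝ} (hr : ∀ s ∈ Q, dist (R.tileCenter s) (R.tileCenter q) ≤ r)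
    {C m : ℕ} {η : ℝ≥0∞} (hC : ∀ m l, n ≤ m → (R.pieces m l).card ≤ C)
    (hm : ∀ k, R.occurrenceCount Q n k ≤ m)
    (hη : ∀ a : Fin (R.num n) × G,
      volume (Metric.cthickening (R.inradius + r) (frontier (R.copySupport n a))) ≤
        η * volume (Metric.ball (0 : E d) R.inradius) * volume (interior (R.copySupport n a)))
    {O : Finset G} (hO : ∀ x ∈ O, shift x Q ⊆ T ∧ (q.1, q.2 + x) ∈ R.copy (n + 3) b) :
    (O.card : ℝ≥0∞) ≤ C ^ 3 * m + η * volume (interior (R.copySupport (n + 3) b)) := by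
  obtain ⟨F, hF, hov, hcard⟩ := R.exists_decomposition n 3 b
  have hFb : ∀ a ∈ F, R.copy n a ⊆ R.copy (n + 3) b := fun a ha => by
    rw [hF]; exact subset_biUnion_of_mem (u := fun b => R.copy n b) ha
  have hβ0 : volume (Metric.ball (0 : E d) R.inradius) ≠ 0 :=
    (Metric.measure_ball_pos _ _ R.inradius_pos).ne'
  have hβt : volume (Metric.ball (0 : E d) R.inradius) ≠ ∞ := measure_ball_lt_top.ne
  have key : ∀ a ∈ F, ((O.filter fun x => (q.1, q.2 + x) ∈ R.copy n a).card : ℝ≥0∞) ≤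
      m + η * volume (interior (R.copySupport n a)) := by
    intro a ha
    rw [← Finset.card_filter_add_card_filter_not (fun x => shift x Q ⊆ R.copy n a), Nat.cast_add]
    refine add_le_add ?_ ?_
    · refine Nat.cast_le.2 ((card_le_occurrenceCount hq (a := a) fun x hx => ?_).trans (hm a.1))
      exact (Finset.mem_filter.1 hx).2
    · refine (ENNReal.mul_le_mul_iff_left hβ0 hβt).1 ?_
      refine (card_crossing_le hT ((hFb a ha).trans hb) hq hr fun x hx => ?_).trans
        ((hη a).trans_eq (by ring))
      simp only [Finset.mem_filter] at hx
      exact ⟨(hO x hx.1.1).1, hx.1.2, hx.2⟩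
  have hsub : O ⊆ F.biUnion fun a => O.filter fun x => (q.1, q.2 + x) ∈ R.copy n a := by
    intro x hx
    have := (hO x hx).2
    rw [hF] at this
    obtain ⟨a, ha, hxa⟩ := mem_iUnion₂.1 this
    exact Finset.mem_biUnion.2 ⟨a, ha, Finset.mem_filter.2 ⟨hx, hxa⟩⟩
  calc (O.card : ℝ≥0∞)
      ≤ ∑ a ∈ F, ((O.filter fun x => (q.1, q.2 + x) ∈ R.copy n a).card : ℝ≥0∞) := by
        exact_mod_cast (Finset.card_le_card hsub).trans Finset.card_biUnion_le
    _ ≤ ∑ a ∈ F, (m + η * volume (interior (R.copySupport n a))) := Finset.sum_le_sum key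
    _ = F.card * m + η * ∑ a ∈ F, volume (interior (R.copySupport n a)) := by
        rw [Finset.sum_add_distrib, Finset.mul_sum]; simp
    _ ≤ C ^ 3 * m + η * volume (interior (R.copySupport (n + 3) b)) := by
        gcongr
        · exact_mod_cast hcard C hC
        · exact hov.sum_volume_interior_le fun a ha => interior_mono (support_mono (hFb a ha))

open Classical in
/-- If every supertile of level `n + 3` contains at least `m` translates of `Q` together with
their displacements by `-w`, where `m` is the largest number of translates of `Q` inside an
`n`-supertile, then, in every fusion tiling, a fixed proportion of the translates of `Q` come with
their displacement by `-w`. -/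
theorem exists_pairs (hd : 0 < d) {T : Set R.Tile} (hT : R.IsFusionTiling T) {n : ℕ}
    {Q : Set R.Tile} {q : R.Tile} (hq : q ∈ Q) {r : ℝ}
    (hr : ∀ s ∈ Q, dist (R.tileCenter s) (R.tileCenter q) ≤ r)
    {C m : ℕ} {η : ℝ≥0∞} (hC : ∀ m l, n ≤ m → (R.pieces m l).card ≤ C)
    (hm : ∀ k, R.occurrenceCount Q n k ≤ m)
    (hη : ∀ a : Fin (R.num n) × G,
      volume (Metric.cthickening (R.inradius + r) (frontier (R.copySupport n a))) ≤
        η * volume (Metric.ball (0 : E d) R.inradius) * volume (interior (R.copySupport n a)))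
    {w : G} (hw : ∀ b : Fin (R.num (n + 3)) × G, ∃ P : Finset G, m ≤ P.card ∧
      ∀ x ∈ P, shift x Q ⊆ R.copy (n + 3) b ∧ shift (x - w) Q ⊆ R.copy (n + 3) b)
    {Δ : ℝ} (hΔ : ∀ b : Fin (R.num (n + 3)) × G, ∀ x ∈ R.copySupport (n + 3) b,
      ∀ y ∈ R.copySupport (n + 3) b, dist x y ≤ Δ)
    {B W : Set (E d)} (hB : Bornology.IsBounded B) (hW : ∀ y ∈ B, ∀ p, dist p y ≤ Δ → p ∈ W)
    {O : Finset G} (hO : ∀ x ∈ O, shift x Q ⊆ T ∧ R.tileCenter q + x ∈ B) :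
    ∃ P : Finset G, (∀ x ∈ P, shift x Q ⊆ T ∧ shift (x - w) Q ⊆ T ∧ R.tileCenter q + x ∈ W) ∧
      (O.card : ℝ≥0∞) ≤ C ^ 3 * P.card + η * volume W := by
  obtain ⟨D, hov, hDT, hDB, hD⟩ := hT.exists_local_decomposition hd (n + 3) hB
  choose P hPm hP using hw
  have hDW : ∀ b ∈ D, R.copySupport (n + 3) b ⊆ W := by
    intro b hb p hp
    obtain ⟨y, hy, hyB⟩ := hDB b hb
    exact hW y hyB p (hΔ b p hp y hy)
  refine ⟨D.biUnion P, ?_, ?_⟩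
  · intro x hx
    obtain ⟨b, hb, hxb⟩ := Finset.mem_biUnion.1 hx
    obtain ⟨h1, h2⟩ := hP b x hxb
    refine ⟨h1.trans (hDT b hb), h2.trans (hDT b hb), hDW b hb ?_⟩
    rw [← R.tileCenter_add]
    exact interior_subset (R.tileCenter_mem_copySupport (mem_of_shift_subset hq h1))
  · have hcardP : (D.biUnion P).card = ∑ b ∈ D, (P b).card := by
      refine Finset.card_biUnion fun b hb c hc hbc => Finset.disjoint_left.2 fun x hxb hxc => ?_
      exact Set.disjoint_left.1 (R.disjoint_copy (hov hb hc hbc))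
        (mem_of_shift_subset hq (hP b x hxb).1) (mem_of_shift_subset hq (hP c x hxc).1)
    have hsub : O ⊆ D.biUnion fun b => O.filter fun x => (q.1, q.2 + x) ∈ R.copy (n + 3) b := by
      intro x hx
      obtain ⟨h1, h2⟩ := hO x hx
      obtain ⟨b, hb, hxb⟩ := hD _ (mem_of_shift_subset hq h1)
        ⟨_, R.tileCenter_mem _, by rw [R.tileCenter_add]; exact h2⟩
      exact Finset.mem_biUnion.2 ⟨b, hb, Finset.mem_filter.2 ⟨hx, hxb⟩⟩
    calc (O.card : ℝ≥0∞)
        ≤ ∑ b ∈ D, ((O.filter fun x => (q.1, q.2 + x) ∈ R.copy (n + 3) b).card : ℝ≥0∞) := by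
          exact_mod_cast (Finset.card_le_card hsub).trans Finset.card_biUnion_le
      _ ≤ ∑ b ∈ D, (C ^ 3 * (P b).card + η * volume (interior (R.copySupport (n + 3) b))) := by
          refine Finset.sum_le_sum fun b hb => ?_
          refine (card_occurrences_copy_le hT.isTiling.overlap (hDT b hb) hq hr hC hm hη
            fun x hx => ?_).trans ?_
          · rw [Finset.mem_filter] at hx
            exact ⟨(hO x hx.1).1, hx.2⟩
          · gcongr
            exact hPm b
      _ = C ^ 3 * (D.biUnion P).card +
            η * ∑ b ∈ D, volume (interior (R.copySupport (n + 3) b)) := by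
          rw [Finset.sum_add_distrib, Finset.mul_sum, hcardP, Nat.cast_sum, Finset.mul_sum]
      _ ≤ _ := by
          gcongr
          exact hov.sum_volume_interior_le fun b hb => interior_subset.trans (hDW b hb)

/-- At arbitrarily high levels `n` there is a displacement `w`, as long as desired, for which the
hypothesis of `exists_pairs` on `w` holds: `w` is the displacement between two copies, inside an
`(n+2)`-supertile, of the `n`-supertile with the most translates of `Q`. -/
theorem exists_displacement (hd : 0 < d) (hP : R.StronglyPrimitive) (hV : R.VanHove)
    (hJ : R.ConstantSupertileNumber) (hne : ∀ n, Nonempty (Fin (R.num n))) {Q : Set R.Tile}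
    {q : R.Tile} (hq : q ∈ Q) (N : ℕ) {ρ : ℝ} (hρ : 0 < ρ) :
    ∃ n m : ℕ, ∃ w : G, N ≤ n ∧ ρ ≤ ‖(w : E d)‖ ∧ (∀ k, R.occurrenceCount Q n k ≤ m) ∧
      ∀ b : Fin (R.num (n + 3)) × G, ∃ P : Finset G, m ≤ P.card ∧
        ∀ x ∈ P, shift x Q ⊆ R.copy (n + 3) b ∧ shift (x - w) Q ⊆ R.copy (n + 3) b := by
  classical
  obtain ⟨N', hN'⟩ := eventually_atTop.1 (hV.eventually_ball_subset hne hρ)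
  obtain ⟨n, hn, hn1, h2⟩ := exists_two_copies hd hP hV hJ hne (max N N')
  have := hne n
  obtain ⟨k, hk⟩ := Finite.exists_max (R.occurrenceCount Q n)
  obtain ⟨l, g, g', hg, hg', hov⟩ := h2 k
  obtain ⟨c, hc⟩ := hN' n ((le_max_right _ _).trans hn) (k, g)
  refine ⟨n, R.occurrenceCount Q n k, g - g', (le_max_left _ _).trans hn,
    le_norm_of_ball_subset hc hov, hk, fun b => ?_⟩
  obtain ⟨h, hh⟩ := hP.exists_mem_pieces (n := n + 2) (by omega) l b.1
  have hlb : R.copy (n + 2) (l, h + b.2) ⊆ R.copy (n + 3) b := copy_subset_of_mem_pieces hh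
  have hin : ∀ g : G, R.copy n (k, g) ⊆ R.copy (n + 2) (l, 0) →
      R.copy n (k, g + (h + b.2)) ⊆ R.copy (n + 3) b := by
    intro g hg
    have h3 := (shift_mono (g := h + b.2) hg)
    rw [← copy_add, ← copy_add, zero_add] at h3
    exact h3.trans hlb
  have hfin := finite_occurrences hq (R.isPatch n k).finite
  refine ⟨hfin.toFinset.image (· + (g + (h + b.2))), ?_, ?_⟩
  · rw [Finset.card_image_of_injective _ (add_left_injective _), occurrenceCount,
      Set.ncard_eq_toFinset_card _ hfin]
  · intro x hx
    obtain ⟨y, hy, rfl⟩ := Finset.mem_image.1 hx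
    have hy' : shift y Q ⊆ R.supertile n k := by simpa using hy
    refine ⟨Subset.trans (shift_subset_copy_iff.2 ?_) (hin g hg),
      Subset.trans (shift_subset_copy_iff.2 ?_) (hin g' hg')⟩
    · simpa using hy'
    · simpa [show y + (g + (h + b.2)) - (g - g') - (g' + (h + b.2)) = y by abel] using hy'

end FusionRule
end FusionTiling

/-! ### Averaging over cubes and recurrence -/

namespace FusionTiling

variable {d : ℕ} {G : AddSubgroup (E d)}

/-- The index of the half-open cell `∏ [ε jᵢ, ε (jᵢ + 1))` of the grid of mesh `ε` containing `x`. -/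
noncomputable def cellIndex (ε : ℝ) (x : E d) : Fin d → ℤ := fun i => ⌊x i / ε⌋

/-- The indices of the cells making up the cube `[-ε L, ε L)^d`. -/
noncomputable def indexBox (d L : ℕ) : Finset (Fin d → ℤ) := Fintype.piFinset fun _ => Finset.Ico (-(L : ℤ)) L

theorem card_indexBox (d L : ℕ) : (indexBox d L).card = (2 * L) ^ d := by
  simp only [indexBox, Fintype.card_piFinset, Int.card_Ico, Finset.prod_const, Finset.card_univ,
    Fintype.card_fin]
  congr 1
  omega

theorem cellIndex_mem_indexBox {ε : ℝ} (hε : 0 < ε) {x : E d} {L : ℕ} :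
    cellIndex ε x ∈ indexBox d L ↔ ∀ i, -(L * ε) ≤ x i ∧ x i < L * ε := by
  simp only [indexBox, Fintype.mem_piFinset, Finset.mem_Ico, cellIndex, Int.le_floor, Int.floor_lt,
    le_div_iff₀ hε, div_lt_iff₀ hε]
  simp

theorem cellIndex_sub {ε : ℝ} (hε : 0 < ε) (x : E d) {y : E d} {j : Fin d → ℤ}
    (hy : ∀ i, y i = ε * j i) : cellIndex ε (x - y) = cellIndex ε x - j := by
  funext i
  simp only [cellIndex, PiLp.sub_apply, hy, sub_div, Pi.sub_apply]
  rw [mul_div_cancel_left₀ _ hε.ne', Int.floor_sub_intCast]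

theorem volume_cube {ε : ℝ} (hε : 0 < ε) (L : ℕ) :
    volume {x : E d | cellIndex ε x ∈ indexBox d L} = ENNReal.ofReal (2 * L * ε) ^ d := by
  have h : {x : E d | cellIndex ε x ∈ indexBox d L} =
      (WithLp.ofLp : E d → Fin d → ℝ) ⁻¹' Set.pi univ fun _ => Ico (-(L * ε)) (L * ε) := by
    ext x
    simp [cellIndex_mem_indexBox hε]
  rw [h, (PiLp.volume_preserving_ofLp (Fin d)).measure_preimage
    (MeasurableSet.univ_pi fun _ => measurableSet_Ico).nullMeasurableSet, Real.volume_pi_Ico]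
  simp only [Finset.prod_const, Finset.card_univ, Fintype.card_fin]
  congr 2
  ring

theorem isBounded_cube {ε : ℝ} (hε : 0 < ε) (L : ℕ) :
    Bornology.IsBounded {x : E d | cellIndex ε x ∈ indexBox d L} := by
  have h : {x : E d | cellIndex ε x ∈ indexBox d L} ⊆
      (WithLp.toLp 2 : (Fin d → ℝ) → E d) '' Set.pi univ fun _ => Icc (-(L * ε)) (L * ε) := by
    intro x hx
    exact ⟨x.ofLp, fun i _ => ⟨((cellIndex_mem_indexBox hε).1 hx i).1,
      ((cellIndex_mem_indexBox hε).1 hx i).2.le⟩, rfl⟩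
  refine (IsCompact.isBounded ?_).subset h
  exact (isCompact_univ_pi fun _ => isCompact_Icc).image (PiLp.continuous_toLp 2 _)

theorem abs_apply_sub_le_dist (x y : E d) (i : Fin d) : |x i - y i| ≤ dist x y := by
  have := PiLp.norm_apply_le (x - y) i
  rwa [PiLp.sub_apply, Real.norm_eq_abs, ← dist_eq_norm] at this

theorem cellIndex_mem_indexBox_of_dist_le {ε : ℝ} (hε : 0 < ε) {x y : E d} {L D : ℕ}
    (hy : cellIndex ε y ∈ indexBox d L) (h : dist x y < D * ε) :
    cellIndex ε x ∈ indexBox d (L + D) := by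
  rw [cellIndex_mem_indexBox hε] at hy ⊢
  intro i
  have h1 := abs_lt.1 ((abs_apply_sub_le_dist x y i).trans_lt h)
  have h2 := hy i
  push_cast
  constructor <;> linarith

namespace FusionRule

variable {R : FusionRule d G}

variable (R) in
/-- The set of fusion tilings that contain a translate of `Q` by a vector of the half-open cell
`[0, ε)^d`. -/
def occursInCell (Q : Set R.Tile) (ε : ℝ) : Set R.TilingSpace :=
  {T | ∃ x : G, cellIndex ε (x : E d) = 0 ∧ shift x Q ⊆ T.1}

theorem shift_subset_shift_iff {Q T : Set R.Tile} {x g : G} :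
    shift x Q ⊆ shift g T ↔ shift (x - g) Q ⊆ T := by
  rw [shift_subset_iff, shift_shift, shift_subset_iff (g := x - g)]
  simp [sub_eq_add_neg]

open Classical in
theorem sum_measure_preimage_eq_lintegral {X I : Type*} [MeasurableSpace X] {μ : Measure X}
    {f : I → X → X} {A : Set X} (hf : ∀ j, Measurable (f j)) (hA : MeasurableSet A)
    (s : Finset I) :
    ∑ j ∈ s, μ (f j ⁻¹' A) = ∫⁻ x, ((s.filter fun j => f j x ∈ A).card : ℝ≥0∞) ∂μ := by
  calc ∑ j ∈ s, μ (f j ⁻¹' A)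
      = ∑ j ∈ s, ∫⁻ x, (f j ⁻¹' A).indicator 1 x ∂μ := by
        refine Finset.sum_congr rfl fun j _ => ?_
        rw [lintegral_indicator_one (hf j hA)]
    _ = ∫⁻ x, ∑ j ∈ s, (f j ⁻¹' A).indicator 1 x ∂μ :=
        (lintegral_finsetSum _ fun j _ => measurable_one.indicator (hf j hA)).symm
    _ = _ := by
        refine lintegral_congr fun x => ?_
        rw [Finset.card_filter, Nat.cast_sum]
        refine Finset.sum_congr rfl fun j _ => ?_
        by_cases h : f j x ∈ A <;> simp [h]

theorem mem_translate_occursInCell {ε : ℝ} (hε : 0 < ε) {g : G} {j : Fin d → ℤ}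
    (hg : ∀ i, (g : E d) i = ε * j i) {Q : Set R.Tile} {T : R.TilingSpace} :
    R.translate (-g) T ∈ R.occursInCell Q ε ↔
      ∃ x : G, cellIndex ε (x : E d) = j ∧ shift x Q ⊆ T.1 := by
  constructor
  · rintro ⟨x, hx, hxT⟩
    refine ⟨x + g, ?_, ?_⟩
    · have := cellIndex_sub hε ((x + g : G) : E d) hg
      rw [AddSubgroup.coe_add, add_sub_cancel_right, hx] at this
      rw [AddSubgroup.coe_add]
      exact (sub_eq_zero.1 this.symm)
    · have := shift_subset_shift_iff.1 hxT
      rwa [sub_neg_eq_add] at this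
  · rintro ⟨x, hx, hxT⟩
    refine ⟨x - g, ?_, shift_subset_shift_iff.2 (by simpa using hxT)⟩
    rw [AddSubgroup.coe_sub, cellIndex_sub hε _ hg, hx, sub_self]

open Classical in
/-- The number of cells of a region that contain the base point of a translate of `Q` is at most
the number of these translates. -/
theorem exists_occurrences {ε : ℝ} (hε : 0 < ε) {z : (Fin d → ℤ) → G}
    (hz : ∀ j i, (z j : E d) i = ε * j i) (Q : Set R.Tile) (T : R.TilingSpace)
    (s : Finset (Fin d → ℤ)) : ∃ O : Finset G,
      (∀ x ∈ O, shift x Q ⊆ T.1 ∧ cellIndex ε (x : E d) ∈ s) ∧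
      (s.filter fun j => R.translate (-z j) T ∈ R.occursInCell Q ε).card ≤ O.card := by
  have h : ∀ j, R.translate (-z j) T ∈ R.occursInCell Q ε →
      ∃ x : G, cellIndex ε (x : E d) = j ∧ shift x Q ⊆ T.1 :=
    fun j => (mem_translate_occursInCell hε (hz j)).1
  choose! x hx hxT using h
  refine ⟨(s.filter fun j => R.translate (-z j) T ∈ R.occursInCell Q ε).image x, ?_, ?_⟩
  · intro y hy
    obtain ⟨j, hj, rfl⟩ := Finset.mem_image.1 hy
    obtain ⟨hjs, hj⟩ := Finset.mem_filter.1 hj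
    exact ⟨hxT j hj, by rwa [hx j hj]⟩
  · rw [Finset.card_image_of_injOn]
    intro j hj k hk hjk
    rw [Finset.mem_coe, Finset.mem_filter] at hj hk
    rw [← hx j hj.2, ← hx k hk.2, hjk]

open Classical in
/-- When a cell contains the base point of at most one translate of `Q`, the pairs of translates
of `Q` with displacement `w` are counted by the cells they are based in. -/
theorem card_pairs_le {ε : ℝ} (hε : 0 < ε) {z : (Fin d → ℤ) → G}
    (hz : ∀ j i, (z j : E d) i = ε * j i) {Q : Set R.Tile} {T : R.TilingSpace}
    (hQ : ∀ x y : G, shift x Q ⊆ T.1 → shift y Q ⊆ T.1 →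
      cellIndex ε (x : E d) = cellIndex ε (y : E d) → x = y)
    {s : Finset (Fin d → ℤ)} {w : G} {A : Set R.TilingSpace}
    (hA : A = R.occursInCell Q ε ∩ R.translate w ⁻¹' R.occursInCell Q ε) {P : Finset G}
    (hP : ∀ x ∈ P, shift x Q ⊆ T.1 ∧ shift (x - w) Q ⊆ T.1 ∧ cellIndex ε (x : E d) ∈ s) :
    P.card ≤ (s.filter fun j => R.translate (-z j) T ∈ A).card := by
  refine Finset.card_le_card_of_injOn (fun x => cellIndex ε (x : E d)) ?_
    fun x hx y hy h => hQ x y (hP x hx).1 (hP y hy).1 h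
  intro x hx
  obtain ⟨h1, h2, h3⟩ := hP x hx
  have h0 : cellIndex ε ((x - z (cellIndex ε (x : E d)) : G) : E d) = 0 := by
    rw [AddSubgroup.coe_sub, cellIndex_sub hε _ (hz _), sub_self]
  refine Finset.mem_coe.2 (Finset.mem_filter.2 ⟨h3, ?_⟩)
  rw [hA]
  refine ⟨⟨_, h0, ?_⟩, ⟨_, h0, ?_⟩⟩
  · refine shift_subset_shift_iff.2 ?_
    simpa using h1
  · refine shift_subset_shift_iff.2 (shift_subset_shift_iff.2 ?_)
    convert h2 using 2
    abel

/-- The volume growth of cubes: a linear inequality between averages over the cubes of sides `L`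
and `L + D` passes to the limit `L → ∞`. -/
theorem le_of_forall_pow_mul_le {a b : ℝ≥0∞} (hb : b ≠ ∞) {D : ℕ}
    (h : ∀ L : ℕ, ((2 * L : ℕ) : ℝ≥0∞) ^ d * a ≤ ((2 * (L + D) : ℕ) : ℝ≥0∞) ^ d * b) : a ≤ b := by
  have h1 : Tendsto (fun L : ℕ => ENNReal.ofReal ((1 + D / (L : ℝ)) ^ d) * b) atTop
      (𝓝 (ENNReal.ofReal ((1 + 0) ^ d) * b)) := by
    refine ENNReal.Tendsto.mul_const (ENNReal.tendsto_ofReal ?_) (Or.inr hb)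
    exact ((tendsto_const_div_atTop_nhds_zero_nat (D : ℝ)).const_add 1).pow d
  simp only [add_zero, one_pow, ENNReal.ofReal_one, one_mul] at h1
  refine ge_of_tendsto h1 (eventually_atTop.2 ⟨1, fun L hL => ?_⟩)
  have hL0 : (0 : ℝ) < L := by exact_mod_cast hL
  have hN : ((2 * L : ℕ) : ℝ≥0∞) ^ d ≠ 0 := pow_ne_zero _ (by simp; omega)
  have hN' : ((2 * L : ℕ) : ℝ≥0∞) ^ d ≠ ∞ := ENNReal.pow_ne_top (ENNReal.natCast_ne_top _)
  refine (ENNReal.mul_le_mul_iff_right hN hN').1 ((h L).trans_eq ?_)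
  rw [← mul_assoc]
  congr 1
  rw [ENNReal.ofReal_pow (by positivity), ← mul_pow]
  congr 1
  rw [← ENNReal.ofReal_natCast, ← ENNReal.ofReal_natCast, ← ENNReal.ofReal_mul (by positivity)]
  congr 1
  push_cast
  field_simp

/-- The measure-theoretic form of recurrence: translates of `Q` recur with arbitrarily long
displacements `w`, at a rate that does not depend on `Q`. -/
theorem exists_recurrence (hd : 0 < d) (hP : R.StronglyPrimitive) (hV : R.VanHove)
    (hJ : R.ConstantSupertileNumber) (hne : ∀ n, Nonempty (Fin (R.num n)))
    {C : ℕ} (hC : ∀ n l, 1 ≤ n → (R.pieces n l).card ≤ C)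
    {μ : Measure R.TilingSpace} [IsProbabilityMeasure μ] (hμ : R.IsInvariant μ)
    {ε : ℝ} (hε : 0 < ε) {z : (Fin d → ℤ) → G} (hz : ∀ j i, (z j : E d) i = ε * j i)
    {Q : Set R.Tile} (hQfin : Q.Finite) (hQne : Q.Nonempty)
    (hQ : ∀ T : R.TilingSpace, ∀ x y : G, shift x Q ⊆ T.1 → shift y Q ⊆ T.1 →
      cellIndex ε (x : E d) = cellIndex ε (y : E d) → x = y)
    (hA : MeasurableSet (R.occursInCell Q ε)) {κ : ℝ≥0∞} (hκ : 0 < κ) (hκ' : κ ≠ ∞)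
    {ρ : ℝ} (hρ : 0 < ρ) :
    ∃ w : G, ρ ≤ ‖(w : E d)‖ ∧ μ (R.occursInCell Q ε) ≤
      C ^ 3 * μ (R.occursInCell Q ε ∩ R.translate w ⁻¹' R.occursInCell Q ε) + κ := by
  classical
  obtain ⟨q, hq⟩ := hQne
  obtain ⟨r, hr0, hr⟩ : ∃ r : ℝ, 0 ≤ r ∧
      ∀ s ∈ Q, dist (R.tileCenter s) (R.tileCenter q) ≤ r := by
    obtain ⟨r, hr⟩ := (hQfin.image fun s => dist (R.tileCenter s) (R.tileCenter q)).bddAbove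
    exact ⟨max r 0, le_max_right _ _, fun s hs => (hr ⟨s, hs, rfl⟩).trans (le_max_left _ _)⟩
  set V : ℝ≥0∞ := ENNReal.ofReal ε ^ d
  have hV0 : V ≠ 0 := pow_ne_zero _ (by simpa using hε)
  have hVt : V ≠ ∞ := ENNReal.pow_ne_top ENNReal.ofReal_ne_top
  set η : ℝ≥0∞ := κ / V with hη
  have hη0 : 0 < η := ENNReal.div_pos hκ.ne' hVt
  have hβ : 0 < volume (Metric.ball (0 : E d) R.inradius) :=
    Metric.measure_ball_pos _ _ R.inradius_pos
  obtain ⟨N, hN⟩ := eventually_atTop.1 (hV.eventually_le_volume_interior hne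
    (ENNReal.mul_pos hη0.ne' hβ.ne') (r := R.inradius + r) (by linarith [R.inradius_pos]))
  obtain ⟨n, m, w, hn, hw, hm, hpair⟩ := exists_displacement hd hP hV hJ hne hq (max N 1) hρ
  have hn1 : 1 ≤ n := (le_max_right _ _).trans hn
  obtain ⟨Δ, hΔ0, hΔ⟩ := R.exists_diam_bound (n + 3)
  obtain ⟨D, hD⟩ := exists_nat_gt (Δ / ε)
  rw [div_lt_iff₀ hε] at hD
  refine ⟨w, hw, ?_⟩
  set A := R.occursInCell Q ε
  obtain ⟨A', hA'def⟩ : ∃ A', A' = A ∩ R.translate w ⁻¹' A := ⟨_, rfl⟩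
  have hA' : MeasurableSet A' := hA'def ▸ hA.inter ((hμ w).measurable hA)
  rw [← hA'def]
  have hcube : ∀ L : ℕ, volume {p : E d | cellIndex ε (p - R.tileCenter q) ∈ indexBox d L} =
      ((2 * L : ℕ) : ℝ≥0∞) ^ d * V := by
    intro L
    have : {p : E d | cellIndex ε (p - R.tileCenter q) ∈ indexBox d L} =
        (fun p => p + -R.tileCenter q) ⁻¹' {x : E d | cellIndex ε x ∈ indexBox d L} := by
      simp [sub_eq_add_neg]
    rw [this, measure_preimage_add_right, volume_cube hε, ENNReal.ofReal_mul (by positivity),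
      mul_pow]
    congr 2
    rw [← ENNReal.ofReal_natCast]
    push_cast
    rfl
  have hpt : ∀ L : ℕ, ∀ T : R.TilingSpace,
      (((indexBox d L).filter fun j => R.translate (-z j) T ∈ A).card : ℝ≥0∞) ≤
      C ^ 3 * ((indexBox d (L + D)).filter fun j => R.translate (-z j) T ∈ A').card +
        η * (((2 * (L + D) : ℕ) : ℝ≥0∞) ^ d * V) := by
    intro L T
    obtain ⟨O, hO, hcard⟩ := exists_occurrences hε hz Q T (indexBox d L)
    have hB : Bornology.IsBounded
        {p : E d | cellIndex ε (p - R.tileCenter q) ∈ indexBox d L} := by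
      refine ((isBounded_cube hε L).add
        (Bornology.isBounded_singleton (x := R.tileCenter q))).subset fun p hp => ?_
      exact ⟨p - R.tileCenter q, hp, _, rfl, by simp⟩
    obtain ⟨P, hPT, hOP⟩ := exists_pairs (T := T.1) hd T.2 hq hr
      (fun m l hm => hC m l (hn1.trans hm)) hm (hN n ((le_max_left _ _).trans hn)) hpair
      (hΔ (n + 3) le_rfl) hB
      (W := {p : E d | cellIndex ε (p - R.tileCenter q) ∈ indexBox d (L + D)})
      (fun y hy p hp => cellIndex_mem_indexBox_of_dist_le hε hy
        (by rw [dist_sub_right]; exact hp.trans_lt hD))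
      (O := O) (fun x hx => ⟨(hO x hx).1, by simpa using (hO x hx).2⟩)
    rw [hcube] at hOP
    refine (Nat.cast_le.2 hcard).trans (hOP.trans ?_)
    gcongr
    refine card_pairs_le hε hz (hQ T) hA'def fun x hx => ⟨(hPT x hx).1, (hPT x hx).2.1, ?_⟩
    simpa using (hPT x hx).2.2
  have hmeas : ∀ j, Measurable fun T => R.translate (-z j) T := fun j => (hμ (-z j)).measurable
  have hsum : ∀ (L : ℕ) {S : Set R.TilingSpace}, MeasurableSet S →
      ∫⁻ T, (((indexBox d L).filter fun j => R.translate (-z j) T ∈ S).card : ℝ≥0∞) ∂μ =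
        ((2 * L : ℕ) : ℝ≥0∞) ^ d * μ S := by
    intro L S hS
    rw [← sum_measure_preimage_eq_lintegral (f := fun j => R.translate (-z j)) hmeas hS]
    simp only [(hμ _).measure_preimage hS.nullMeasurableSet, Finset.sum_const, card_indexBox]
    simp
  refine le_of_forall_pow_mul_le (d := d) (D := D) ?_ fun L => ?_
  · exact ENNReal.add_ne_top.2 ⟨ENNReal.mul_ne_top (ENNReal.pow_ne_top (ENNReal.natCast_ne_top _))
      (measure_ne_top _ _), hκ'⟩
  · rw [← hsum L hA]
    refine (lintegral_mono (hpt L)).trans ?_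
    rw [lintegral_add_right _ measurable_const, lintegral_const_mul' _ _
      (ENNReal.pow_ne_top (ENNReal.natCast_ne_top _)), hsum (L + D) hA', lintegral_const,
      measure_univ, mul_one, hη]
    refine le_of_eq ?_
    rw [mul_comm _ V, ← mul_assoc (κ / V), ENNReal.div_mul_cancel hV0 hVt]
    ring

/-- Under strong mixing, the recurrence rate `C ^ (-3)` is a lower bound for the measure of every
such set which is not null. -/
theorem StronglyMixing.eq_zero_or_le (hd : 0 < d) (hP : R.StronglyPrimitive) (hV : R.VanHove)
    (hJ : R.ConstantSupertileNumber) (hne : ∀ n, Nonempty (Fin (R.num n)))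
    {C : ℕ} (hC : ∀ n l, 1 ≤ n → (R.pieces n l).card ≤ C)
    {μ : Measure R.TilingSpace} [IsProbabilityMeasure μ] (hμ : R.IsInvariant μ)
    (hmix : R.StronglyMixing μ)
    {ε : ℝ} (hε : 0 < ε) {z : (Fin d → ℤ) → G} (hz : ∀ j i, (z j : E d) i = ε * j i)
    {Q : Set R.Tile} (hQfin : Q.Finite) (hQne : Q.Nonempty)
    (hQ : ∀ T : R.TilingSpace, ∀ x y : G, shift x Q ⊆ T.1 → shift y Q ⊆ T.1 →
      cellIndex ε (x : E d) = cellIndex ε (y : E d) → x = y)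
    (hA : MeasurableSet (R.occursInCell Q ε)) :
    μ (R.occursInCell Q ε) = 0 ∨ 1 ≤ C ^ 3 * μ (R.occursInCell Q ε) := by
  set A := R.occursInCell Q ε
  have h := fun i : ℕ => exists_recurrence hd hP hV hJ hne hC hμ hε hz hQfin hQne hQ hA
    (κ := ((i : ℝ≥0∞) + 1)⁻¹) (by simp) (by simp) (ρ := (i : ℝ) + 1) (by positivity)
  choose w hw hrec using h
  have hlim := hmix A A hA hA w <| tendsto_atTop_mono hw <|
    tendsto_atTop_add_const_right _ _ tendsto_natCast_atTop_atTop
  have h0 : Tendsto (fun i : ℕ => ((i : ℝ≥0∞) + 1)⁻¹) atTop (𝓝 0) := by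
    have := (tendsto_add_atTop_iff_nat 1).2 ENNReal.tendsto_inv_nat_nhds_zero
    simpa using this
  have hlim2 := (ENNReal.Tendsto.const_mul (a := (C : ℝ≥0∞) ^ 3) hlim
    (Or.inr (ENNReal.pow_ne_top (ENNReal.natCast_ne_top _)))).add h0
  have hle : μ A ≤ C ^ 3 * (μ A * μ A) + 0 := ge_of_tendsto' hlim2 hrec
  by_cases h0 : μ A = 0
  · exact Or.inl h0
  · right
    rw [add_zero, ← mul_assoc] at hle
    exact (ENNReal.mul_le_mul_iff_left h0 (measure_ne_top _ _)).1 (by rwa [one_mul])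

end FusionRule
end FusionTiling

/-! ### Sets of small positive measure -/

namespace FusionTiling

variable {d : ℕ} {G : AddSubgroup (E d)}

theorem dist_le_of_cellIndex {ε : ℝ} (hε : 0 < ε) (hd : 0 < d) {x y : E d} {m : ℕ}
    (h : ∀ i, |cellIndex ε x i - cellIndex ε y i| ≤ m) : dist x y ≤ d * ((m + 1) * ε) := by
  have hi : ∀ i, dist (x i) (y i) ≤ (m + 1) * ε := by
    intro i
    have h1 : (|cellIndex ε x i - cellIndex ε y i| : ℝ) ≤ m := by exact_mod_cast h i
    have h2 : |x i / ε - y i / ε| ≤ m + 1 := by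
      have := Int.floor_le (x i / ε)
      have := Int.lt_floor_add_one (x i / ε)
      have := Int.floor_le (y i / ε)
      have := Int.lt_floor_add_one (y i / ε)
      simp only [cellIndex] at h1
      rw [abs_le] at h1 ⊢
      constructor <;> linarith [h1.1, h1.2]
    rwa [← sub_div, abs_div, abs_of_pos hε, div_le_iff₀ hε, ← Real.dist_eq] at h2
  rw [EuclideanSpace.dist_eq]
  refine Real.sqrt_le_iff.2 ⟨by positivity, ?_⟩
  calc ∑ i, dist (x i) (y i) ^ 2 ≤ ∑ _i : Fin d, ((m + 1) * ε) ^ 2 :=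
        Finset.sum_le_sum fun i _ => pow_le_pow_left₀ dist_nonneg (hi i) 2
    _ = d * ((m + 1) * ε) ^ 2 := by simp
    _ ≤ (d * ((m + 1) * ε)) ^ 2 := by
        rw [mul_pow (d : ℝ)]
        have : (1 : ℝ) ≤ d := by exact_mod_cast hd
        exact mul_le_mul_of_nonneg_right (le_self_pow₀ this two_ne_zero) (by positivity)

namespace FusionRule

variable {R : FusionRule d G}

theorem exists_mem_tiling (T : R.TilingSpace) (p : E d) :
    ∃ t ∈ T.1, p ∈ tileSupport R.shape t := by
  have : p ∈ support R.shape T.1 := by rw [T.2.isTiling.covers]; trivial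
  obtain ⟨t, ht, hp⟩ := mem_iUnion₂.1 this
  exact ⟨t, ht, hp⟩

theorem shift_singleton (g : G) (t : R.Tile) : shift g ({t} : Set R.Tile) = {(t.1, t.2 + g)} := by
  simp [shift]

/-- In a tiling, occurrences of a tile at a small distance from each other coincide. -/
theorem eq_of_dist_lt (T : R.TilingSpace) {t : R.Tile} {x y : G}
    (hx : shift x {t} ⊆ T.1) (hy : shift y {t} ⊆ T.1)
    (h : dist (x : E d) y < R.inradius) : x = y := by
  rw [shift_singleton, singleton_subset_iff] at hx hy
  have := IsPacking.eq_of_tileCenter_mem (R := R) T.2.isTiling.overlap hx hy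
    (R.ball_subset_tileSupport _ (by
      rw [R.tileCenter_add, R.tileCenter_add, Metric.mem_ball, dist_add_left]
      exact h))
  exact add_left_cancel (congrArg Prod.snd this)

theorem measure_occursInCell_ne_zero {μ : Measure R.TilingSpace} [IsProbabilityMeasure μ]
    (hμ : R.IsInvariant μ) {ε : ℝ} (hε : 0 < ε) {z : (Fin d → ℤ) → G}
    (hz : ∀ j i, (z j : E d) i = ε * j i) {Q : Set R.Tile}
    (hA : MeasurableSet (R.occursInCell Q ε)) (hQ : ∀ T : R.TilingSpace, ∃ x, shift x Q ⊆ T.1) :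
    μ (R.occursInCell Q ε) ≠ 0 := by
  intro h0
  have hcov : (⋃ j, R.translate (-z j) ⁻¹' R.occursInCell Q ε) = univ := by
    refine eq_univ_of_forall fun T => ?_
    obtain ⟨x, hx⟩ := hQ T
    exact mem_iUnion.2 ⟨_, (mem_translate_occursInCell hε (hz _)).2 ⟨x, rfl, hx⟩⟩
  have := measure_iUnion_null (μ := μ) (s := fun j => R.translate (-z j) ⁻¹' R.occursInCell Q ε)
    fun j => by rw [(hμ _).measure_preimage hA.nullMeasurableSet, h0]
  rw [hcov, measure_univ] at this
  exact one_ne_zero this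

theorem measurableSet_occursInCell_singleton (t : R.Tile) (ε : ℝ) :
    MeasurableSet (R.occursInCell {t} ε) := by
  refine MeasurableSpace.measurableSet_generateFrom
    ⟨{t}, {v : G | cellIndex ε ((-v : G) : E d) = 0}, isPatch_singleton t, ?_, ?_⟩
  · have hm : Measurable fun v : G => cellIndex ε ((-v : G) : E d) := by
      refine measurable_pi_lambda _ fun i => Int.measurable_floor.comp ?_
      have : Continuous fun v : G => ((-v : G) : E d) i / ε := by
        simp only [AddSubgroup.coe_neg, PiLp.neg_apply]
        fun_prop
      exact this.measurable
    exact hm (measurableSet_singleton 0)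
  · ext T
    constructor
    · rintro ⟨x, hx, hxT⟩
      exact ⟨-x, by simpa using hx, by simpa using hxT⟩
    · rintro ⟨v, hv, hvT⟩
      exact ⟨-v, hv, hvT⟩

/-- For the full translation group, a single tile and a fine grid give sets of small positive
measure. -/
theorem not_stronglyMixing_top (hd : 0 < d) {R : FusionRule d ⊤} (hP : R.StronglyPrimitive)
    (hV : R.VanHove) (hJ : R.ConstantSupertileNumber) (hK : R.BoundedTransitionMatrices)
    {μ : Measure R.TilingSpace} [IsProbabilityMeasure μ] (hμ : R.IsInvariant μ) :
    ¬ R.StronglyMixing μ := by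
  intro hmix
  obtain ⟨C, hC⟩ := exists_card_pieces_le hJ hK
  obtain ⟨T₀⟩ := nonempty_of_isProbabilityMeasure μ
  obtain ⟨t, ht, -⟩ := exists_mem_tiling T₀ 0
  have hocc : ∀ T : R.TilingSpace, ∃ x, shift x {t} ⊆ T.1 := by
    intro T
    obtain ⟨g, hg⟩ := T₀.2.exists_tile hd hP T.2 ht
    exact ⟨g - t.2, by simpa [shift_singleton] using hg⟩
  -- so fine that no two occurrences of the tile have their base points among the first `C ^ 3 + 1` cells
  -- along the diagonal
  set ε : ℝ := R.inradius / (2 * (d * (C ^ 3 + 1))) with hεdef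
  have hd' : (0 : ℝ) < d := by exact_mod_cast hd
  have hε : 0 < ε := div_pos R.inradius_pos (by positivity)
  have hεlt : d * (((C ^ 3 : ℕ) + 1) * ε) < R.inradius := by
    have : d * (((C ^ 3 : ℕ) + 1) * ε) = R.inradius / 2 := by
      rw [hεdef]; push_cast; field_simp
    rw [this]
    exact half_lt_self R.inradius_pos
  have hclose : ∀ T : R.TilingSpace, ∀ x y, shift x {t} ⊆ T.1 → shift y {t} ⊆ T.1 →
      (∀ i, |cellIndex ε (x : E d) i - cellIndex ε (y : E d) i| ≤ (C ^ 3 : ℕ)) → x = y :=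
    fun T x y hx hy h => eq_of_dist_lt T hx hy ((dist_le_of_cellIndex hε hd h).trans_lt hεlt)
  set z : (Fin d → ℤ) → (⊤ : AddSubgroup (E d)) :=
    fun j => ⟨WithLp.toLp 2 fun i => ε * j i, trivial⟩
  have hz : ∀ j i, (z j : E d) i = ε * j i := fun j i => rfl
  have hA := measurableSet_occursInCell_singleton t ε
  have hne := fun n => nonempty_of_isFusionTiling hd T₀.2 n
  rcases hmix.eq_zero_or_le hd hP hV hJ hne hC hμ hε hz (finite_singleton t)
    (singleton_nonempty t) (fun T x y hx hy h => hclose T x y hx hy fun i => by simp [h]) hA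
    with h0 | h1
  · exact measure_occursInCell_ne_zero hμ hε hz hA hocc h0
  · have hdis : ((Finset.range (C ^ 3 + 1) : Finset ℕ) : Set ℕ).PairwiseDisjoint
        fun k => R.translate (-z fun _ => (k : ℤ)) ⁻¹' R.occursInCell {t} ε := by
      intro k hk l hl hkl
      refine Set.disjoint_left.2 fun T hTk hTl => hkl ?_
      obtain ⟨x, hx, hxT⟩ := (mem_translate_occursInCell hε (hz _)).1 hTk
      obtain ⟨y, hy, hyT⟩ := (mem_translate_occursInCell hε (hz _)).1 hTl
      have hxy : x = y := by
        refine hclose T x y hxT hyT fun i => ?_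
        have hk' := Finset.mem_range.1 (Finset.mem_coe.1 hk)
        have hl' := Finset.mem_range.1 (Finset.mem_coe.1 hl)
        rw [hx, hy]
        beta_reduce
        rw [abs_le]
        constructor <;> omega
      subst hxy
      have := congrFun (hx.symm.trans hy) ⟨0, hd⟩
      exact_mod_cast this
    have hsum := sum_measure_le_measure_univ (μ := μ)
      (fun k (_ : k ∈ Finset.range (C ^ 3 + 1)) =>
        ((hμ (-z fun _ => (k : ℤ))).measurable hA).nullMeasurableSet)
      (fun k hk l hl hkl => (hdis hk hl hkl).aedisjoint)
    simp only [(hμ _).measure_preimage hA.nullMeasurableSet, Finset.sum_const, Finset.card_range,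
      measure_univ, nsmul_eq_mul, Nat.cast_add, Nat.cast_pow, Nat.cast_one, add_mul, one_mul] at hsum
    have hpos := measure_occursInCell_ne_zero hμ hε hz hA hocc
    have hlt : (1 : ℝ≥0∞) < C ^ 3 * μ (R.occursInCell {t} ε) + μ (R.occursInCell {t} ε) :=
      h1.trans_lt (ENNReal.lt_add_right (ENNReal.mul_ne_top
        (ENNReal.pow_ne_top (ENNReal.natCast_ne_top _)) (measure_ne_top _ _)) hpos)
    exact absurd hsum (not_le.2 hlt)

end FusionRule

theorem eq_of_cellIndex_eq {x y : integerLattice d}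
    (h : cellIndex 1 (x : E d) = cellIndex 1 (y : E d)) : x = y := by
  refine Subtype.ext (PiLp.ext fun i => ?_)
  have := congrFun h i
  obtain ⟨m, hm⟩ := x.2 i
  obtain ⟨k, hk⟩ := y.2 i
  simp only [cellIndex, hm, hk, div_one, Int.floor_intCast] at this
  rw [hm, hk, this]

instance : Countable (integerLattice d) :=
  Function.Injective.countable (f := fun x : integerLattice d => cellIndex 1 (x : E d))
    fun _ _ h => eq_of_cellIndex_eq h

theorem cellIndex_zero (ε : ℝ) : cellIndex ε (0 : E d) = 0 := by
  funext i
  simp [cellIndex]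

namespace FusionRule

variable {R : FusionRule d (integerLattice d)}

/-- For integer translations and the unit grid, each cell contains a single translation vector. -/
theorem occursInCell_one (Q : Set R.Tile) : R.occursInCell Q 1 = {T | Q ⊆ T.1} := by
  ext T
  constructor
  · rintro ⟨x, hx, hxT⟩
    have : x = 0 := eq_of_cellIndex_eq (by rw [hx, AddSubgroup.coe_zero, cellIndex_zero])
    rwa [this, shift_zero] at hxT
  · exact fun h => ⟨0, cellIndex_zero 1, by rwa [shift_zero]⟩

theorem measurableSet_mem (t : R.Tile) : MeasurableSet {T : R.TilingSpace | t ∈ T.1} := by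
  have := measurableSet_occursInCell_singleton (R := R) t 1
  rw [occursInCell_one] at this
  simpa only [singleton_subset_iff] using this

theorem measurableSet_subset {Q : Set R.Tile} (hQ : Q.Finite) :
    MeasurableSet {T : R.TilingSpace | Q ⊆ T.1} := by
  have : {T : R.TilingSpace | Q ⊆ T.1} = ⋂ t ∈ Q, {T | t ∈ T.1} := by
    ext T
    simp [subset_def]
  rw [this]
  exact hQ.measurableSet_biInter fun t _ => measurableSet_mem t

theorem mem_translate_iff {g : integerLattice d} {t : R.Tile} {T : R.TilingSpace} :
    t ∈ (R.translate g T).1 ↔ (t.1, t.2 - g) ∈ T.1 := mem_shift _ _ _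

/-- A tile of one tiling that is missing from another one cannot belong to almost all tilings:
otherwise some tiling contains all its translates, among them one that conflicts with a copy of
the tile that takes its place in the second tiling. -/
theorem measure_mem_lt_one (hd : 0 < d) (hP : R.StronglyPrimitive) {μ : Measure R.TilingSpace}
    [IsProbabilityMeasure μ] (hμ : R.IsInvariant μ) {t : R.Tile} {T' : R.TilingSpace}
    (ht : t ∉ T'.1) : μ {T : R.TilingSpace | t ∈ T.1} < 1 := by
  refine lt_of_le_of_ne prob_le_one fun h1 => ?_
  have hall : ∀ᵐ T ∂μ, ∀ g, t ∈ (R.translate (-g) T).1 := by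
    refine ae_all_iff.2 fun g => ?_
    have := (hμ (-g)).quasiMeasurePreserving.ae
      ((mem_ae_iff_prob_eq_one (measurableSet_mem t)).2 h1)
    exact this
  obtain ⟨T, hT⟩ := hall.exists
  obtain ⟨s, hs, hts⟩ := exists_mem_tiling T' (R.tileCenter t)
  obtain ⟨g, hg⟩ := T'.2.exists_tile hd hP T.2 hs
  have h2 : (t.1, t.2 + (g - s.2)) ∈ T.1 := by
    have := mem_translate_iff.1 (hT (g - s.2))
    rwa [sub_neg_eq_add] at this
  have h3 : (s.1, s.2 + (g - s.2)) ∈ T.1 := by simpa using hg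
  have heq := IsPacking.eq_of_tileCenter_mem (R := R) T.2.isTiling.overlap h2 h3 (by
    rw [R.tileCenter_add, tileSupport_add]
    exact ⟨_, hts, rfl⟩)
  obtain ⟨h1, h2⟩ := Prod.mk.inj heq
  have : t = s := Prod.ext h1 (add_right_cancel h2)
  exact ht (this ▸ hs)

/-- Under strong mixing, adding far away translates of `t` to a finite set of tiles multiplies the
measure of the set of tilings containing it by almost the measure for `t`. -/
theorem StronglyMixing.exists_finite_small {μ : Measure R.TilingSpace} [IsProbabilityMeasure μ]
    (hmix : R.StronglyMixing μ) {t : R.Tile} (h0 : μ {T : R.TilingSpace | t ∈ T.1} ≠ 0)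
    {v : ℕ → integerLattice d} (hv : Tendsto (fun n => ‖(v n : E d)‖) atTop atTop) {θ : ℝ≥0∞}
    (hθ : μ {T : R.TilingSpace | t ∈ T.1} < θ) (k : ℕ) :
    ∃ Q : Set R.Tile, Q.Finite ∧ Q.Nonempty ∧ μ {T : R.TilingSpace | Q ⊆ T.1} ≠ 0 ∧
      μ {T : R.TilingSpace | Q ⊆ T.1} ≤ θ ^ k := by
  induction k with
  | zero => exact ⟨{t}, finite_singleton t, singleton_nonempty t, by simpa using h0,
      by simpa using prob_le_one⟩
  | succ k ih =>
    obtain ⟨Q, hQ, hQne, hQ0, hQk⟩ := ih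
    set a := μ {T : R.TilingSpace | Q ⊆ T.1}
    have hlim := hmix _ _ (measurableSet_subset hQ) (measurableSet_mem t) v hv
    have hlo : 0 < a * μ {T : R.TilingSpace | t ∈ T.1} := ENNReal.mul_pos hQ0 h0
    have hhi : a * μ {T : R.TilingSpace | t ∈ T.1} < a * θ :=
      ENNReal.mul_lt_mul_right hQ0 (measure_ne_top _ _) hθ
    obtain ⟨n, hn⟩ := (hlim.eventually (Ioo_mem_nhds hlo hhi)).exists
    have hset : {T : R.TilingSpace | insert (t.1, t.2 - v n) Q ⊆ T.1} =
        {T | Q ⊆ T.1} ∩ R.translate (v n) ⁻¹' {T | t ∈ T.1} := by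
      ext T
      simp only [insert_subset_iff, mem_ofPred_eq, mem_inter_iff, mem_preimage, mem_translate_iff]
      exact and_comm
    refine ⟨insert (t.1, t.2 - v n) Q, hQ.insert _, insert_nonempty _ _, ?_, ?_⟩
    · rw [hset]
      exact hn.1.ne'
    · rw [hset, pow_succ]
      exact hn.2.le.trans (mul_le_mul_left hQk _)

/-- For integer translations, mixing itself supplies finite sets of tiles of small positive
probability. -/
theorem not_stronglyMixing_integerLattice (hd : 0 < d) (hP : R.StronglyPrimitive)
    (hV : R.VanHove) (hJ : R.ConstantSupertileNumber) (hK : R.BoundedTransitionMatrices)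
    (hX : Nontrivial R.TilingSpace) {μ : Measure R.TilingSpace} [IsProbabilityMeasure μ]
    (hμ : R.IsInvariant μ) : ¬ R.StronglyMixing μ := by
  intro hmix
  obtain ⟨C, hC⟩ := exists_card_pieces_le hJ hK
  obtain ⟨T, T', t, ht, ht'⟩ : ∃ T T' : R.TilingSpace, ∃ t, t ∈ T.1 ∧ t ∉ T'.1 := by
    obtain ⟨T, T', hne⟩ := hX
    by_cases hsub : T.1 ⊆ T'.1
    · have : ¬ T'.1 ⊆ T.1 := fun h => hne (Subtype.ext (hsub.antisymm h))
      obtain ⟨t, h1, h2⟩ := not_subset.1 this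
      exact ⟨T', T, t, h1, h2⟩
    · obtain ⟨t, h1, h2⟩ := not_subset.1 hsub
      exact ⟨T, T', t, h1, h2⟩
  set z : (Fin d → ℤ) → integerLattice d :=
    fun j => ⟨WithLp.toLp 2 fun i => (j i : ℝ), fun i => ⟨j i, rfl⟩⟩
  have hz : ∀ j i, (z j : E d) i = 1 * j i := fun j i => by rw [one_mul]
  have hpos : μ {T : R.TilingSpace | t ∈ T.1} ≠ 0 := by
    have := measure_occursInCell_ne_zero hμ one_pos hz
      (measurableSet_occursInCell_singleton t 1) fun S => by
        obtain ⟨g, hg⟩ := T.2.exists_tile hd hP S.2 ht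
        exact ⟨g - t.2, by simpa [shift_singleton] using hg⟩
    rw [occursInCell_one] at this
    simpa only [singleton_subset_iff] using this
  obtain ⟨θ, hθ, hθ1⟩ := exists_between (measure_mem_lt_one hd hP hμ ht')
  have hv : Tendsto (fun n : ℕ => ‖(z (fun _ => (n : ℤ)) : E d)‖) atTop atTop := by
    refine tendsto_atTop_mono (fun n => ?_) (tendsto_natCast_atTop_atTop (R := ℝ))
    have := PiLp.norm_apply_le (z (fun _ => (n : ℤ)) : E d) ⟨0, hd⟩
    simpa [hz] using this
  have hCt : (C : ℝ≥0∞) ^ 3 ≠ ∞ := ENNReal.pow_ne_top (ENNReal.natCast_ne_top _)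
  have hlim := ENNReal.Tendsto.const_mul (a := (C : ℝ≥0∞) ^ 3)
    (ENNReal.tendsto_pow_atTop_nhds_zero_of_lt_one hθ1) (Or.inr hCt)
  rw [mul_zero] at hlim
  obtain ⟨k, hk⟩ := (hlim.eventually (gt_mem_nhds one_pos)).exists
  obtain ⟨Q, hQ, hQne, hQ0, hQk⟩ := hmix.exists_finite_small hpos hv hθ k
  have hA : MeasurableSet (R.occursInCell Q 1) := by
    rw [occursInCell_one]; exact measurableSet_subset hQ
  rcases hmix.eq_zero_or_le hd hP hV hJ (fun n => nonempty_of_isFusionTiling hd T.2 n) hC hμ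
    one_pos hz hQ hQne (fun _ _ _ _ _ h => eq_of_cellIndex_eq h) hA with h0 | h1
  · rw [occursInCell_one] at h0
    exact hQ0 h0
  · rw [occursInCell_one] at h1
    exact absurd (h1.trans (mul_le_mul_right hQk _)) (not_le.2 hk)

end FusionRule
end FusionTiling

theorem mainTheorem9 (d : ℕ) (hd : 0 < d) :
    (∀ R : FusionTiling.FusionRule d ⊤,
      R.StronglyPrimitive → R.VanHove → R.FiniteLocalComplexity →
      R.ConstantSupertileNumber → R.BoundedTransitionMatrices →
      ∀ μ : MeasureTheory.Measure R.TilingSpace, MeasureTheory.IsProbabilityMeasure μ →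
        R.IsInvariant μ → ¬ R.StronglyMixing μ) ∧
    (∀ R : FusionTiling.FusionRule d (FusionTiling.integerLattice d),
      R.StronglyPrimitive → R.VanHove →
      R.ConstantSupertileNumber → R.BoundedTransitionMatrices →
      Nontrivial R.TilingSpace →
      ∀ μ : MeasureTheory.Measure R.TilingSpace, MeasureTheory.IsProbabilityMeasure μ →
        R.IsInvariant μ → ¬ R.StronglyMixing μ) := by
  constructor
  · intro R hP hV _ hJ hK μ _ hμ
    exact FusionTiling.FusionRule.not_stronglyMixing_top hd hP hV hJ hK hμ
  · intro R hP hV hJ hK hX μ _ hμ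
    exact FusionTiling.FusionRule.not_stronglyMixing_integerLattice hd hP hV hJ hK hX hμ
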